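/- Let $\nu>2$ be a real number, let $n,p\ge 0$ be arbitrary integers (in particular $n<p$ is allowed), let $X\in\mathbb{R}^{n\times p}$ be any matrix with rows $\mathbf{x}_1^T,\dots,\mathbf{x}_n^T$, let $\mathbf{y}\in\{0,1\}^n$, $\boldsymbol\beta_a\in\mathbb{R}^p$, and let $\Sigma_a\in\mathbb{R}^{p\times p}$ be symmetric positive definite. Let $F_\nu$ be the distribution function of Student's $t$-distribution with $\nu$ degrees of freedom (location $0$, scale $1$), and let $\pi(\cdot\mid\mathbf{y})$ be the posterior density of $\boldsymbol\beta$ in the robit model in which, given $\boldsymbol\beta$, the responses $Y_i$ are independent with $P(Y_i=1\mid\boldsymbol\beta)=F_\nu(\mathbf{x}_i^T\boldsymbol\beta)$, and $\boldsymbol\beta\sim\mathcal{N}_p(\boldsymbol\beta_a,\Sigma_a^{-1})$; that is, $\pi(\boldsymbol\beta\mid\mathbf{y})$ is proportional to the product of the likelihood of $\mathbf{y}$ and the prior density. The robit data augmentation (DA) Markov chain on $\mathbb{R}^p$ moves from $\boldsymbol\beta$ to $\boldsymbol\beta'$ as follows. First draw independent $z_1,\dots,z_n$, where $z_i$ has the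 $t_\nu(\mathbf{x}_i^T\boldsymbol\beta,1)$ distribution (location $\mathbf{x}_i^T\boldsymbol\beta$, scale $1$) truncated to $(0,\infty)$ if $y_i=1$ and to $(-\infty,0]$ if $y_i=0$. Then, given $\mathbf{z}$, draw independent $\lambda_i\sim\mathrm{Gamma}\left(\frac{\nu+1}{2},\frac{\nu+(z_i-\mathbf{x}_i^T\boldsymbol\beta)^2}{2}\right)$ (shape, rate). Finally, with $\Lambda=\mathrm{diag}(\lambda_1,\dots,\lambda_n)$, draw $$\boldsymbol\beta'\sim\mathcal{N}_p\left((X^T\Lambda X+\Sigma_a)^{-1}(X^T\Lambda\mathbf{z}+\Sigma_a\boldsymbol\beta_a),\ (X^T\Lambda X+\Sigma_a)^{-1}\right).$$ Its transition density is $$k(\boldsymbol\beta,\boldsymbol\beta')=\int_{\mathbb{R}_+^n}\int_{\mathbb{R}^n}\pi(\boldsymbol\beta'\mid\boldsymbol\lambda,\mathbf{z},\mathbf{y})\,\pi(\boldsymbol\lambda\mid\mathbf{z},\boldsymbol\beta,\mathbf{y})\,\pi(\mathbf{z}\mid\boldsymbol\beta,\mathbf{y})\,d\mathbf{z}\,d\boldsymbol\lambda,$$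 where the three factors are the densities of the distributions just described. Then $\pi(\cdot\mid\mathbf{y})$ and every $k(\boldsymbol\beta,\cdot)$ are probability densities, and the Markov operator $$(Kf)(\boldsymbol\beta)=\int_{\mathbb{R}^p}f(\boldsymbol\beta')\,k(\boldsymbol\beta,\boldsymbol\beta')\,d\boldsymbol\beta'$$ is a well-defined, bounded, positive self-adjoint operator on the Hilbert space $L^2_0(\pi(\cdot\mid\mathbf{y}))$ of real functions that are square integrable with mean zero with respect to $\pi(\cdot\mid\mathbf{y})$. This operator $K$ is trace class, that is, $\sum_j\langle |K|e_j,e_j\rangle<\infty$ for every orthonormal basis $(e_j)$, where $|K|=(K^*K)^{1/2}$. Moreover $$\int_{\mathbb{R}^p}k(\boldsymbol\beta,\boldsymbol\beta)\,d\boldsymbol\beta<\infty.$$ -/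

import Mathlib

open MeasureTheory

noncomputable section

namespace Robit

/-! ### Trace class operators and Markov operators -/

/-- A bounded operator `T` on a real Hilbert space is trace class if its absolute value
`A = |T|` (the positive operator with `A² = T* T`) has finite trace: `∑ ⟪A eᵢ, eᵢ⟫ < ∞` for
every orthonormal basis `(eᵢ)`. -/
def IsTraceClass {H : Type*} [NormedAddCommGroup H] [InnerProductSpace ℝ H] [CompleteSpace H]
    (T : H →L[ℝ] H) : Prop :=
  ∃ A : H →L[ℝ] H, A.IsPositive ∧ A.comp A = (ContinuousLinearMap.adjoint T).comp T ∧
    ∀ (w : Set H) (b : HilbertBasis w ℝ H), Summable fun i => inner ℝ (A (b i)) (b i)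

/-- `L²₀(μ)`: the square integrable functions with mean zero. -/
def meanZeroL2 {E : Type*} [MeasurableSpace E] (μ : Measure E) [IsFiniteMeasure μ] :
    Submodule ℝ (Lp ℝ 2 μ) where
  carrier := {f | ∫ x, f x ∂μ = 0}
  zero_mem' := by
    have h := integral_congr_ae (Lp.coeFn_zero ℝ 2 μ)
    simpa using h
  add_mem' := by
    intro f g hf hg
    have hf' : Integrable f μ := (Lp.memLp f).integrable (by norm_num)
    have hg' : Integrable g μ := (Lp.memLp g).integrable (by norm_num)
    have h := integral_congr_ae (Lp.coeFn_add f g)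
    simp only [Pi.add_apply] at h
    rw [integral_add hf' hg'] at h
    simp only [Set.mem_ofPred_eq] at hf hg ⊢
    rw [h, hf, hg, add_zero]
  smul_mem' := by
    intro c f hf
    have h := integral_congr_ae (Lp.coeFn_smul c f)
    simp only [Pi.smul_apply, integral_smul] at h
    simp only [Set.mem_ofPred_eq] at hf ⊢
    rw [h, hf, smul_zero]

theorem isClosed_meanZeroL2 {E : Type*} [MeasurableSpace E] (μ : Measure E)
    [IsFiniteMeasure μ] : IsClosed (meanZeroL2 μ : Set (Lp ℝ 2 μ)) := by
  have h : (meanZeroL2 μ : Set (Lp ℝ 2 μ)) = {f | inner ℝ (indicatorConstLp 2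
      MeasurableSet.univ (measure_ne_top μ Set.univ) (1 : ℝ)) f = 0} := by
    ext f
    simp only [Set.mem_ofPred_eq]
    rw [L2.inner_indicatorConstLp_one MeasurableSet.univ (measure_ne_top μ Set.univ) f,
      Measure.restrict_univ]
    rfl
  rw [h]
  exact isClosed_eq (by fun_prop) continuous_const

instance {E : Type*} [MeasurableSpace E] (μ : Measure E) [IsFiniteMeasure μ] :
    CompleteSpace (meanZeroL2 μ) :=
  (isClosed_meanZeroL2 μ).completeSpace_coe

/-- `K` is the operator on `L²₀(μ)` given by `(K f)(x) = ∫ f(x') P(x, dx')` for the family of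
transition measures `P(x, ·)`. -/
def IsMarkovOperator {E : Type*} [MeasurableSpace E] (P : E → Measure E) (μ : Measure E)
    [IsFiniteMeasure μ] (K : meanZeroL2 μ →L[ℝ] meanZeroL2 μ) : Prop :=
  ∀ f : meanZeroL2 μ, ∀ᵐ x ∂μ, Integrable (f : Lp ℝ 2 μ) (P x) ∧
    (K f : Lp ℝ 2 μ) x = ∫ x', (f : Lp ℝ 2 μ) x' ∂(P x)

/-! ### Densities -/

/-- Density of the Student distribution `t_ν(μ, 1)`. -/
def studentPDF (ν μ x : ℝ) : ℝ :=
  Real.Gamma ((ν + 1) / 2) / (Real.sqrt (ν * Real.pi) * Real.Gamma (ν / 2)) *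
    (1 + (x - μ) ^ 2 / ν) ^ (-((ν + 1) / 2))

/-- The distribution function `F_ν` of `t_ν(0, 1)`. -/
def studentCDF (ν x : ℝ) : ℝ := ∫ t in Set.Iic x, studentPDF ν 0 t

/-- The half line of latent values `z` that give the response `y`, where `y = 1_{z > 0}`. -/
def halfLine (y : Bool) : Set ℝ := if y then Set.Ioi 0 else Set.Iic 0

/-- Density of `t_ν(μ, 1)` truncated to the half line that belongs to the response `y`. -/
def truncStudentPDF (ν μ : ℝ) (y : Bool) (z : ℝ) : ℝ :=
  (halfLine y).indicator (studentPDF ν μ) z / ∫ t in halfLine y, studentPDF ν μ t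

/-- Density of the `p`-variate normal distribution with mean `m` and covariance matrix `S`. -/
def normalPDF {p : ℕ} (m : Fin p → ℝ) (S : Matrix (Fin p) (Fin p) ℝ) (x : Fin p → ℝ) : ℝ :=
  (Real.sqrt ((2 * Real.pi) ^ p * S.det))⁻¹ *
    Real.exp (-(dotProduct (x - m) (S⁻¹.mulVec (x - m))) / 2)

/-! ### The robit model, its posterior and the data augmentation chain

`X` is the design matrix with rows `xᵢ`, `y` the vector of responses (`true` is `1`, `false` is
`0`), `βa` the prior mean and `Sa` the prior precision matrix. -/

/-- `P(Y = y ∣ β)`. -/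
def likelihood {n p : ℕ} (ν : ℝ) (X : Matrix (Fin n) (Fin p) ℝ) (y : Fin n → Bool)
    (β : Fin p → ℝ) : ℝ :=
  ∏ i, if y i then studentCDF ν (X.mulVec β i) else 1 - studentCDF ν (X.mulVec β i)

/-- The measure with density likelihood times prior, before normalization. -/
def unnormalizedPosterior {n p : ℕ} (ν : ℝ) (X : Matrix (Fin n) (Fin p) ℝ) (y : Fin n → Bool)
    (βa : Fin p → ℝ) (Sa : Matrix (Fin p) (Fin p) ℝ) : Measure (Fin p → ℝ) :=
  volume.withDensity fun β => ENNReal.ofReal (likelihood ν X y β * normalPDF βa Sa⁻¹ β)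

/-- The posterior distribution of `β` given `Y = y`. -/
def posterior {n p : ℕ} (ν : ℝ) (X : Matrix (Fin n) (Fin p) ℝ) (y : Fin n → Bool)
    (βa : Fin p → ℝ) (Sa : Matrix (Fin p) (Fin p) ℝ) : Measure (Fin p → ℝ) :=
  (unnormalizedPosterior ν X y βa Sa Set.univ)⁻¹ • unnormalizedPosterior ν X y βa Sa

instance {n p : ℕ} (ν : ℝ) (X : Matrix (Fin n) (Fin p) ℝ) (y : Fin n → Bool)
    (βa : Fin p → ℝ) (Sa : Matrix (Fin p) (Fin p) ℝ) :
    IsFiniteMeasure (posterior ν X y βa Sa) := by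
  refine ⟨?_⟩
  rw [posterior, Measure.smul_apply, smul_eq_mul]
  exact lt_of_le_of_lt (ENNReal.inv_mul_le_one _) ENNReal.one_lt_top

/-- Density of `z` given `β, y`: independent truncated Student variables. -/
def zCondPDF {n p : ℕ} (ν : ℝ) (X : Matrix (Fin n) (Fin p) ℝ) (y : Fin n → Bool)
    (β : Fin p → ℝ) (z : Fin n → ℝ) : ℝ :=
  ∏ i, truncStudentPDF ν (X.mulVec β i) (y i) (z i)

/-- Density of `lam` given `z, β, y`: independent Gamma variables with shape `(ν + 1) / 2` and
rates `(ν + (zᵢ - xᵢᵀβ)²) / 2`. -/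
def lamCondPDF {n p : ℕ} (ν : ℝ) (X : Matrix (Fin n) (Fin p) ℝ) (β : Fin p → ℝ)
    (z lam : Fin n → ℝ) : ℝ :=
  ∏ i, ProbabilityTheory.gammaPDFReal ((ν + 1) / 2) ((ν + (z i - X.mulVec β i) ^ 2) / 2) (lam i)

/-- Density of `β` given `lam, z, y`: normal with covariance matrix `(XᵀΛX + Sa)⁻¹` and mean
`(XᵀΛX + Sa)⁻¹ (XᵀΛz + Sa βa)`, where `Λ = diag(lam)`. -/
def betaCondPDF {n p : ℕ} (X : Matrix (Fin n) (Fin p) ℝ) (βa : Fin p → ℝ)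
    (Sa : Matrix (Fin p) (Fin p) ℝ) (lam z : Fin n → ℝ) (β : Fin p → ℝ) : ℝ :=
  let C : Matrix (Fin p) (Fin p) ℝ := (X.transpose * Matrix.diagonal lam * X + Sa)⁻¹
  normalPDF (C.mulVec ((X.transpose * Matrix.diagonal lam).mulVec z + Sa.mulVec βa)) C β

/-- The transition density `k(β, β')` of the data augmentation chain: draw `z` given `β`, then
`lam` given `z, β`, then `β'` given `lam, z`. -/
def transitionDensity {n p : ℕ} (ν : ℝ) (X : Matrix (Fin n) (Fin p) ℝ) (y : Fin n → Bool)
    (βa : Fin p → ℝ) (Sa : Matrix (Fin p) (Fin p) ℝ) (β β' : Fin p → ℝ) : ENNReal :=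
  ∫⁻ lam in {lam : Fin n → ℝ | ∀ i, 0 < lam i}, ∫⁻ z : Fin n → ℝ,
    ENNReal.ofReal (betaCondPDF X βa Sa lam z β' * lamCondPDF ν X β z lam * zCondPDF ν X y β z)

/-- The transition measure `k(β, β') dβ'`. -/
def transition {n p : ℕ} (ν : ℝ) (X : Matrix (Fin n) (Fin p) ℝ) (y : Fin n → Bool)
    (βa : Fin p → ℝ) (Sa : Matrix (Fin p) (Fin p) ℝ) (β : Fin p → ℝ) : Measure (Fin p → ℝ) :=
  volume.withDensity (transitionDensity ν X y βa Sa β)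

end Robit

end

noncomputable section

namespace Robit

open ProbabilityTheory

/-! ### One-dimensional densities -/

/-! Write `t = (lam, z)` for the latent pair, `h(β, t)` for its density given `β`, `b(β, t)` for the
normal full conditional of `β`, and `u` for the posterior density. The Student law is a Gamma scale
mixture of normals, so `u(β) h(β, t)` depends on `β` only through a Gaussian factor, and completing
the square identifies that factor with `b(β, t)` up to a constant: `u(β) h(β, t) = w(t) b(β, t)`.
Let `D = b / u`, a kernel between `L²(u)` and `L²(w)`. Both conditional laws have total mass one,
and the chain operator is `A* A`, where `A` integrates against `D`; hence it is positive. By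
Bessel's inequality its trace on mean-zero functions is at most the squared `L²` norm of `D`, and by
the balance relation this norm is exactly `∫ k(β, β) dβ`. This abstract part ends in
`exists_positive_isTraceClass_dataAugmentation`.

It remains to bound the diagonal, which `exists_betaCondPDF_le` makes possible. Let `bᵢ` be the
Gamma rates and `G = ∑ bᵢ lamᵢ`. The precision matrix and the weighted residuals are bounded by
multiples of `1 + G`, so `β` can be far from the origin only if `G` is large or `β` is far from its
conditional mean. The second case is paid for by the normal density and the first by `exp (G / 2)`.
On the diagonal the residuals in `G` are those of the very `β` that generated `lam`, so the Gamma
density absorbs `exp (G / 2)` at the cost of the constant `2 ^ (n (ν + 1) / 2)`, whatever `z` and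
`β` are (`lintegral_exp_mul_latentPDF`). What is left is a multiple of `(1 + ‖β‖) ^ (-(p + 1))`,
which is integrable on `ℝ^p`. -/

lemma lintegral_pi_ofReal_prod {ι : Type*} [Fintype ι] (μ : ι → Measure ℝ) [∀ i, SigmaFinite (μ i)]
    {f : ι → ℝ → ℝ} (hf : ∀ i x, 0 ≤ f i x) (hint : ∀ i, Integrable (f i) (μ i)) :
    ∫⁻ x, ENNReal.ofReal (∏ i, f i (x i)) ∂(Measure.pi μ)
      = ∏ i, ∫⁻ x, ENNReal.ofReal (f i x) ∂(μ i) := by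
  rw [← ofReal_integral_eq_lintegral_ofReal (Integrable.fintype_prod hint)
    (ae_of_all _ fun x => Finset.prod_nonneg fun i _ => hf i (x i)),
    integral_fintype_prod_eq_prod,
    ENNReal.ofReal_prod_of_nonneg fun i _ => integral_nonneg (hf i)]
  exact Finset.prod_congr rfl fun i _ =>
    ofReal_integral_eq_lintegral_ofReal (hint i) (ae_of_all _ (hf i))

lemma setLIntegral_Ioi_gammaPDF {a r : ℝ} (ha : 0 < a) (hr : 0 < r) :
    ∫⁻ x in Set.Ioi 0, gammaPDF a r x = 1 := by
  rw [setLIntegral_congr Ioi_ae_eq_Ici, ← lintegral_gammaPDF_eq_one ha hr,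
    ← lintegral_indicator measurableSet_Ici]
  refine lintegral_congr fun x => ?_
  by_cases hx : 0 ≤ x
  · rw [Set.indicator_of_mem (by exact hx)]
  · rw [Set.indicator_of_notMem (by exact hx), gammaPDF_of_neg (not_le.mp hx)]

lemma integrable_gammaPDFReal {a r : ℝ} (ha : 0 < a) (hr : 0 < r) :
    Integrable (gammaPDFReal a r) :=
  lintegral_ofReal_ne_top_iff_integrable (by fun_prop)
    (ae_of_all _ (gammaPDFReal_nonneg ha hr)) |>.mp (by
      rw [show (∫⁻ x, ENNReal.ofReal (gammaPDFReal a r x)) = 1 from lintegral_gammaPDF_eq_one ha hr]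
      simp)

/-- Half of the exponential decay can be spent on a tilt. The price `2 ^ a` does not involve the
rate, so the resulting bounds are uniform in the residuals. -/
lemma exp_mul_gammaPDFReal {a r : ℝ} (hr : 0 < r) (x : ℝ) :
    Real.exp (r * x / 2) * gammaPDFReal a r x = 2 ^ a * gammaPDFReal a (r / 2) x := by
  unfold gammaPDFReal
  split_ifs
  · rw [Real.div_rpow hr.le (by norm_num), show -(r * x) = -(r / 2 * x) + -(r * x / 2) by ring,
      Real.exp_add, Real.exp_neg (r * x / 2)]
    have := Real.exp_pos (r * x / 2)
    field_simp
  · simp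

section Student

variable {ν : ℝ}

lemma studentPDF_pos (hν : 0 < ν) (μ x : ℝ) : 0 < studentPDF ν μ x := by
  have h1 := Real.Gamma_pos_of_pos (show 0 < (ν + 1) / 2 by positivity)
  have h2 := Real.Gamma_pos_of_pos (show 0 < ν / 2 by positivity)
  have := Real.pi_pos
  unfold studentPDF
  positivity

lemma measurable_studentPDF (ν : ℝ) :
    Measurable fun q : ℝ × ℝ => studentPDF ν q.1 q.2 := by
  unfold studentPDF
  fun_prop

/-- The scale mixture representation: both sides are the joint density of `l ~ Gamma(ν/2, ν/2)` and
`z ~ N(μ, 1/l)`, disintegrated in the two possible orders. -/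
lemma studentPDF_mul_gammaPDFReal (hν : 0 < ν) (μ z : ℝ) {l : ℝ} (hl : 0 < l) :
    studentPDF ν μ z * gammaPDFReal ((ν + 1) / 2) ((ν + (z - μ) ^ 2) / 2) l
      = gammaPDFReal (ν / 2) (ν / 2) l * gaussianPDFReal μ (Real.toNNReal l⁻¹) z := by
  have h1 := Real.Gamma_pos_of_pos (show 0 < (ν + 1) / 2 by positivity)
  have h2 := Real.Gamma_pos_of_pos (show 0 < ν / 2 by positivity)
  have hpi := Real.pi_pos
  have hr : 0 < ν + (z - μ) ^ 2 := by positivity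
  simp only [gammaPDFReal, if_pos hl.le, studentPDF, gaussianPDFReal,
    Real.coe_toNNReal _ (inv_pos.mpr hl).le]
  have e1 : (1 + (z - μ) ^ 2 / ν) ^ (-((ν + 1) / 2)) * ((ν + (z - μ) ^ 2) / 2) ^ ((ν + 1) / 2)
      = (ν / 2) ^ (ν / 2) * Real.sqrt (ν / 2) := by
    rw [show (ν + (z - μ) ^ 2) / 2 = (1 + (z - μ) ^ 2 / ν) * (ν / 2) by field_simp,
      Real.mul_rpow (by positivity) (by positivity), ← mul_assoc, ← Real.rpow_add (by positivity),
      neg_add_cancel, Real.rpow_zero, one_mul, Real.sqrt_eq_rpow, ← Real.rpow_add (by positivity)]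
    congr 1; ring
  have e2 : l ^ ((ν + 1) / 2 - 1) = l ^ (ν / 2 - 1) * Real.sqrt l := by
    rw [Real.sqrt_eq_rpow, ← Real.rpow_add hl]; congr 1; ring
  have e3 : Real.exp (-((ν + (z - μ) ^ 2) / 2 * l))
      = Real.exp (-(ν / 2 * l)) * Real.exp (-(z - μ) ^ 2 / (2 * l⁻¹)) := by
    rw [← Real.exp_add]; congr 1; field_simp; ring
  have e4 : Real.sqrt (ν / 2) * Real.sqrt l / Real.sqrt (ν * Real.pi)
      = (Real.sqrt (2 * Real.pi * l⁻¹))⁻¹ := by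
    rw [← Real.sqrt_mul (by positivity), ← Real.sqrt_div (by positivity), ← Real.sqrt_inv]
    congr 1; field_simp
  rw [e2, e3, ← e4]
  calc _ = ((1 + (z - μ) ^ 2 / ν) ^ (-((ν + 1) / 2)) *
          ((ν + (z - μ) ^ 2) / 2) ^ ((ν + 1) / 2)) * Real.sqrt l / Real.sqrt (ν * Real.pi) /
          Real.Gamma (ν / 2) * l ^ (ν / 2 - 1) *
          (Real.exp (-(ν / 2 * l)) * Real.exp (-(z - μ) ^ 2 / (2 * l⁻¹))) := by
        field_simp
    _ = _ := by rw [e1]; field_simp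

lemma measurable_gammaPDFReal_uncurry (a : ℝ) :
    Measurable fun q : ℝ × ℝ => gammaPDFReal a q.1 q.2 := by
  unfold gammaPDFReal
  exact Measurable.ite (measurableSet_le measurable_const measurable_snd) (by fun_prop)
    measurable_const

lemma measurable_gaussianPDFReal_uncurry (μ : ℝ) :
    Measurable fun q : ℝ × ℝ => gaussianPDFReal μ (Real.toNNReal q.1⁻¹) q.2 := by
  unfold gaussianPDFReal
  fun_prop

/-- Insert the Gamma density of total mass one, exchange the two factorizations of the mixture, and
integrate the Gaussian in `z` first. -/
lemma lintegral_studentPDF (hν : 0 < ν) (μ : ℝ) :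
    ∫⁻ z, ENNReal.ofReal (studentPDF ν μ z) = 1 := by
  have hG := measurable_gaussianPDFReal_uncurry μ
  calc ∫⁻ z, ENNReal.ofReal (studentPDF ν μ z)
      = ∫⁻ z, ∫⁻ l in Set.Ioi 0, ENNReal.ofReal (studentPDF ν μ z) *
          gammaPDF ((ν + 1) / 2) ((ν + (z - μ) ^ 2) / 2) l := by
        refine lintegral_congr fun z => ?_
        rw [lintegral_const_mul' _ _ ENNReal.ofReal_ne_top,
          setLIntegral_Ioi_gammaPDF (by positivity) (by positivity), mul_one]
    _ = ∫⁻ z, ∫⁻ l in Set.Ioi 0, gammaPDF (ν / 2) (ν / 2) l *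
          ENNReal.ofReal (gaussianPDFReal μ (Real.toNNReal l⁻¹) z) := by
        refine lintegral_congr fun z => setLIntegral_congr_fun measurableSet_Ioi fun l hl => ?_
        simp only [gammaPDF]
        rw [← ENNReal.ofReal_mul (studentPDF_pos hν _ _).le, studentPDF_mul_gammaPDFReal hν μ z hl,
          ENNReal.ofReal_mul (gammaPDFReal_nonneg (by positivity) (by positivity) _)]
    _ = ∫⁻ l in Set.Ioi 0, ∫⁻ z, gammaPDF (ν / 2) (ν / 2) l *
          ENNReal.ofReal (gaussianPDFReal μ (Real.toNNReal l⁻¹) z) := by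
        refine lintegral_lintegral_swap (Measurable.aemeasurable ?_)
        exact (((measurable_gammaPDFReal _ _).comp measurable_snd).ennreal_ofReal).mul
          (hG.comp measurable_swap).ennreal_ofReal
    _ = ∫⁻ l in Set.Ioi 0, gammaPDF (ν / 2) (ν / 2) l := by
        refine setLIntegral_congr_fun measurableSet_Ioi fun l hl => ?_
        rw [gammaPDF, lintegral_const_mul' _ _ ENNReal.ofReal_ne_top, lintegral_gaussianPDFReal_eq_one,
          mul_one]
        have : 0 < l⁻¹ := inv_pos.mpr hl
        simpa using this
    _ = 1 := setLIntegral_Ioi_gammaPDF (by positivity) (by positivity)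

lemma integrable_studentPDF (hν : 0 < ν) (μ : ℝ) : Integrable (studentPDF ν μ) :=
  lintegral_ofReal_ne_top_iff_integrable
    ((measurable_studentPDF ν).comp measurable_prodMk_left).aestronglyMeasurable
    (ae_of_all _ fun z => (studentPDF_pos hν μ z).le) |>.mp (by simp [lintegral_studentPDF hν])

lemma integral_studentPDF (hν : 0 < ν) (μ : ℝ) : ∫ z, studentPDF ν μ z = 1 := by
  rw [integral_eq_lintegral_of_nonneg_ae (ae_of_all _ fun z => (studentPDF_pos hν μ z).le)
    (integrable_studentPDF hν μ).1, lintegral_studentPDF hν, ENNReal.toReal_one]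

lemma measurableSet_halfLine (y : Bool) : MeasurableSet (halfLine y) := by
  cases y
  · exact measurableSet_Iic
  · exact measurableSet_Ioi

lemma integral_halfLine_studentPDF_pos (hν : 0 < ν) (μ : ℝ) (y : Bool) :
    0 < ∫ t in halfLine y, studentPDF ν μ t := by
  rw [setIntegral_pos_iff_support_of_nonneg_ae
    (ae_of_all _ fun z => (studentPDF_pos hν μ z).le) (integrable_studentPDF hν μ).integrableOn,
    show Function.support (studentPDF ν μ) = Set.univ from
      Set.eq_univ_of_forall fun z => (studentPDF_pos hν μ z).ne', Set.univ_inter]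
  cases y <;> simp [halfLine]

lemma integral_halfLine_studentPDF (hν : 0 < ν) (μ : ℝ) (y : Bool) :
    ∫ t in halfLine y, studentPDF ν μ t
      = if y then studentCDF ν μ else 1 - studentCDF ν μ := by
  have h : ∫ t in Set.Ioi 0, studentPDF ν μ t = studentCDF ν μ := by
    -- The reflection `t ↦ μ - t` carries `(0, ∞)` onto the open half line `(-∞, μ)`, so the
    -- endpoint is dropped first.
    rw [studentCDF, integral_Iic_eq_integral_Iio, ← integral_indicator measurableSet_Iio,
      ← integral_indicator measurableSet_Ioi,
      ← integral_sub_left_eq_self (Set.indicator (Set.Iio μ) (studentPDF ν 0)) volume μ]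
    refine integral_congr_ae (ae_of_all _ fun t => ?_)
    have e : studentPDF ν μ t = studentPDF ν 0 (μ - t) := by
      simp only [studentPDF, sub_zero, ← neg_sub t μ, neg_sq]
    simp only [Set.indicator_apply, Set.mem_Ioi, Set.mem_Iio, sub_lt_self_iff, e]
  cases y
  · have h2 := integral_add_compl (measurableSet_Ioi (a := (0 : ℝ))) (integrable_studentPDF hν μ)
    rw [Set.compl_Ioi, integral_studentPDF hν, h] at h2
    simp only [halfLine, Bool.false_eq_true, if_false]
    linarith
  · simpa [halfLine] using h

end Student

/-! ### Multivariate normal densities -/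

section Normal

variable {p : ℕ}

open scoped MatrixOrder in
lemma exists_eq_transpose_mul_self {Q : Matrix (Fin p) (Fin p) ℝ} (hQ : Q.PosSemidef) :
    ∃ B : Matrix (Fin p) (Fin p) ℝ, Q = B.transpose * B := by
  obtain ⟨B, hB⟩ := CStarAlgebra.nonneg_iff_eq_star_mul_self.mp hQ.nonneg
  exact ⟨B, by rw [hB, Matrix.star_eq_conjTranspose, Matrix.conjTranspose_eq_transpose_of_trivial]⟩

lemma dotProduct_transpose_mul_self_mulVec (B : Matrix (Fin p) (Fin p) ℝ) (x : Fin p → ℝ) :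
    dotProduct x ((B.transpose * B).mulVec x) = ∑ i, (B.mulVec x i) ^ 2 := by
  rw [← Matrix.mulVec_mulVec, Matrix.dotProduct_mulVec, Matrix.vecMul_transpose, dotProduct]
  simp only [sq]

/-- With `Q = BᵀB`, the `j`-th entry of `Q x` is the inner product of the `j`-th column of `B` with
`B x`; apply Cauchy–Schwarz. -/
lemma sq_mulVec_le {Q : Matrix (Fin p) (Fin p) ℝ} (hQ : Q.PosSemidef) (x : Fin p → ℝ)
    (j : Fin p) : (Q.mulVec x j) ^ 2 ≤ Q j j * dotProduct x (Q.mulVec x) := by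
  obtain ⟨B, rfl⟩ := exists_eq_transpose_mul_self hQ
  rw [dotProduct_transpose_mul_self_mulVec, ← Matrix.mulVec_mulVec]
  have h : (B.transpose * B) j j = ∑ k, (B k j) ^ 2 := by
    simp [Matrix.mul_apply, sq]
  rw [h]
  simpa [Matrix.mulVec, dotProduct] using
    Finset.sum_mul_sq_le_sq_mul_sq Finset.univ (fun k => B k j) (B.mulVec x)

lemma lintegral_comp_mulVec {B : Matrix (Fin p) (Fin p) ℝ} (hB : B.det ≠ 0)
    {g : (Fin p → ℝ) → ENNReal} (hg : Measurable g) :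
    ∫⁻ x, g (B.mulVec x) = ENNReal.ofReal |B.det⁻¹| * ∫⁻ x, g x := by
  have h := Real.map_matrix_volume_pi_eq_smul_volume_pi hB
  have hm : Measurable (Matrix.toLin' B) := (LinearMap.continuous_on_pi _).measurable
  rw [← smul_eq_mul, ← lintegral_smul_measure, ← h, lintegral_map hg hm]
  simp

/-- Factor `S⁻¹ = BᵀB`; the substitution `x ↦ B (x - m)` gives a product of standard normal
densities. -/
lemma lintegral_normalPDF (m : Fin p → ℝ) {S : Matrix (Fin p) (Fin p) ℝ} (hS : S.PosDef) :
    ∫⁻ x, ENNReal.ofReal (normalPDF m S x) = 1 := by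
  obtain ⟨B, hB⟩ := exists_eq_transpose_mul_self hS.inv.posSemidef
  have hdet : S.det = (B.det ^ 2)⁻¹ := by
    have := congrArg Matrix.det hB
    rw [Matrix.det_mul, Matrix.det_transpose, Matrix.det_nonsing_inv, Ring.inverse_eq_inv'] at this
    rw [sq, ← this, inv_inv]
  have hB0 : B.det ≠ 0 := by
    intro h
    have := hS.det_pos
    simp [hdet, h] at this
  have hgm : Measurable fun x : Fin p → ℝ => ENNReal.ofReal (∏ i, gaussianPDFReal 0 1 (x i)) := by
    have := measurable_gaussianPDFReal 0 1
    fun_prop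
  have key : ∀ x, normalPDF m S x = |B.det| * ∏ i, gaussianPDFReal 0 1 (B.mulVec (x - m) i) := by
    intro x
    simp only [normalPDF, gaussianPDFReal]
    rw [hB, dotProduct_transpose_mul_self_mulVec, Finset.prod_mul_distrib, ← Real.exp_sum, hdet,
      Real.sqrt_mul (by positivity), Real.sqrt_inv, Real.sqrt_sq_eq_abs, mul_inv, inv_inv]
    simp only [Finset.prod_const, Finset.card_univ, Fintype.card_fin, sub_zero, NNReal.coe_one,
      mul_one]
    rw [← Finset.sum_div, Finset.sum_neg_distrib, inv_pow,
      show Real.sqrt ((2 * Real.pi) ^ p) = Real.sqrt (2 * Real.pi) ^ p by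
        rw [Real.sqrt_eq_iff_mul_self_eq (by positivity) (by positivity), ← mul_pow,
          Real.mul_self_sqrt (by positivity)]]
    ring
  simp_rw [key]
  rw [lintegral_sub_right_eq_self
    (fun x => ENNReal.ofReal (|B.det| * ∏ i, gaussianPDFReal 0 1 (B.mulVec x i))) m]
  simp_rw [ENNReal.ofReal_mul (abs_nonneg B.det)]
  rw [lintegral_const_mul' _ _ ENNReal.ofReal_ne_top, lintegral_comp_mulVec hB0 hgm,
    volume_pi, lintegral_pi_ofReal_prod _ (fun _ => gaussianPDFReal_nonneg 0 1)
      (fun _ => integrable_gaussianPDFReal 0 1)]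
  simp only [lintegral_gaussianPDFReal_eq_one 0 one_ne_zero, Finset.prod_const_one, mul_one]
  rw [← ENNReal.ofReal_mul (abs_nonneg _), ← abs_mul, mul_inv_cancel₀ hB0]
  simp

lemma normalPDF_pos (m : Fin p → ℝ) {S : Matrix (Fin p) (Fin p) ℝ} (hS : S.PosDef)
    (x : Fin p → ℝ) : 0 < normalPDF m S x := by
  have := hS.det_pos
  have := Real.pi_pos
  unfold normalPDF
  positivity

lemma measurable_det {α : Type*} [MeasurableSpace α] {R : α → Matrix (Fin p) (Fin p) ℝ}
    (hR : ∀ i j, Measurable fun a => R a i j) : Measurable fun a => (R a).det := by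
  simp only [Matrix.det_apply]
  refine Finset.measurable_sum _ fun σ _ => Measurable.const_smul ?_ _
  exact Finset.measurable_prod _ fun i _ => hR _ _

lemma measurable_inv_apply {α : Type*} [MeasurableSpace α] {Q : α → Matrix (Fin p) (Fin p) ℝ}
    (hQ : ∀ i j, Measurable fun a => Q a i j) (i j : Fin p) :
    Measurable fun a => (Q a)⁻¹ i j := by
  simp only [Matrix.inv_def, Ring.inverse_eq_inv', Matrix.smul_apply, smul_eq_mul,
    Matrix.adjugate_apply]
  refine (measurable_det hQ).inv.mul (measurable_det fun k l => ?_)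
  by_cases h : k = j
  · simp [h, Matrix.updateRow_self]
  · simpa [Matrix.updateRow_ne h] using hQ k l

lemma measurable_mulVec_apply {α : Type*} [MeasurableSpace α] {m : ℕ}
    {R : α → Matrix (Fin m) (Fin p) ℝ} {v : α → Fin p → ℝ}
    (hR : ∀ i j, Measurable fun a => R a i j) (hv : ∀ i, Measurable fun a => v a i) (i : Fin m) :
    Measurable fun a => (R a).mulVec (v a) i := by
  simp only [Matrix.mulVec, dotProduct]
  exact Finset.measurable_sum _ fun j _ => (hR i j).mul (hv j)

lemma measurable_normalPDF {α : Type*} [MeasurableSpace α] {S : α → Matrix (Fin p) (Fin p) ℝ}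
    {m x : α → Fin p → ℝ} (hS : ∀ i j, Measurable fun a => S a i j)
    (hm : ∀ i, Measurable fun a => m a i) (hx : ∀ i, Measurable fun a => x a i) :
    Measurable fun a => normalPDF (m a) (S a) (x a) := by
  unfold normalPDF
  have h1 := measurable_det hS
  have h2 : ∀ i, Measurable fun a => (x a - m a) i := fun i => (hx i).sub (hm i)
  have h3 : Measurable fun a => dotProduct (x a - m a) ((S a)⁻¹.mulVec (x a - m a)) := by
    simp only [dotProduct]
    exact Finset.measurable_sum _ fun j _ =>
      (h2 j).mul (measurable_mulVec_apply (measurable_inv_apply hS) h2 j)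
  fun_prop

end Normal

/-! ### The full conditional of the regression coefficients -/

section BetaCond

variable {n p : ℕ} (X : Matrix (Fin n) (Fin p) ℝ) (βa : Fin p → ℝ)
  {Sa : Matrix (Fin p) (Fin p) ℝ}

lemma measurable_betaCondPDF (Sa : Matrix (Fin p) (Fin p) ℝ) :
    Measurable fun q : (Fin p → ℝ) × (Fin n → ℝ) × (Fin n → ℝ) =>
      betaCondPDF X βa Sa q.2.1 q.2.2 q.1 := by
  have hXL : ∀ i j, Measurable fun q : (Fin p → ℝ) × (Fin n → ℝ) × (Fin n → ℝ) =>
      (X.transpose * Matrix.diagonal q.2.1) i j := by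
    intro i j
    simp only [Matrix.mul_diagonal]
    fun_prop
  have hC := measurable_inv_apply (Q := fun q : (Fin p → ℝ) × (Fin n → ℝ) × (Fin n → ℝ) =>
    X.transpose * Matrix.diagonal q.2.1 * X + Sa) (by
      intro i j
      simp only [Matrix.add_apply]
      refine Measurable.add_const ?_ _
      change Measurable fun q : (Fin p → ℝ) × (Fin n → ℝ) × (Fin n → ℝ) =>
        ∑ k, (X.transpose * Matrix.diagonal q.2.1) i k * X k j
      exact Finset.measurable_sum _ fun k _ => (hXL i k).mul_const _)
  unfold betaCondPDF
  refine measurable_normalPDF hC (measurable_mulVec_apply hC fun i => ?_) fun i => by fun_prop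
  simp only [Pi.add_apply]
  exact (measurable_mulVec_apply hXL (fun i => by fun_prop) i).add_const _

variable {X} in
lemma posDef_precision (hSa : Sa.PosDef) {lam : Fin n → ℝ} (hlam : ∀ i, 0 < lam i) :
    (X.transpose * Matrix.diagonal lam * X + Sa).PosDef := by
  refine Matrix.PosDef.posSemidef_add ?_ hSa
  have h : (Matrix.diagonal lam).PosSemidef := Matrix.PosSemidef.diagonal fun i => (hlam i).le
  simpa using h.conjTranspose_mul_mul_same X

variable {X} in
lemma betaCondPDF_pos (hSa : Sa.PosDef) {lam : Fin n → ℝ} (hlam : ∀ i, 0 < lam i)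
    (z : Fin n → ℝ) (β : Fin p → ℝ) : 0 < betaCondPDF X βa Sa lam z β :=
  normalPDF_pos _ (posDef_precision hSa hlam).inv _

variable {X} in
lemma lintegral_betaCondPDF (hSa : Sa.PosDef) {lam : Fin n → ℝ} (hlam : ∀ i, 0 < lam i)
    (z : Fin n → ℝ) : ∫⁻ β, ENNReal.ofReal (betaCondPDF X βa Sa lam z β) = 1 :=
  lintegral_normalPDF _ (posDef_precision hSa hlam).inv

end BetaCond

lemma sub_dotProduct_mulVec_sub {p : ℕ} {A : Matrix (Fin p) (Fin p) ℝ} (hA : A.transpose = A)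
    (x m : Fin p → ℝ) : dotProduct (x - m) (A.mulVec (x - m))
      = dotProduct x (A.mulVec x) - 2 * dotProduct x (A.mulVec m) + dotProduct m (A.mulVec m) := by
  have h : dotProduct m (A.mulVec x) = dotProduct x (A.mulVec m) := by
    rw [Matrix.dotProduct_mulVec, ← Matrix.mulVec_transpose, hA, dotProduct_comm]
  rw [Matrix.mulVec_sub, sub_dotProduct, dotProduct_sub, dotProduct_sub, h]
  ring

lemma transpose_eq_of_posDef {p : ℕ} {A : Matrix (Fin p) (Fin p) ℝ} (hA : A.PosDef) :
    A.transpose = A := by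
  rw [← Matrix.conjTranspose_eq_transpose_of_trivial]; exact hA.isHermitian

section BetaCond

variable {n p : ℕ} {X : Matrix (Fin n) (Fin p) ℝ} {βa : Fin p → ℝ}
  {Sa : Matrix (Fin p) (Fin p) ℝ}

lemma mul_inv_mulVec {Q : Matrix (Fin p) (Fin p) ℝ} (hQ : Q.PosDef) (v : Fin p → ℝ) :
    Q.mulVec (Q⁻¹.mulVec v) = v := by
  rw [Matrix.mulVec_mulVec, Matrix.mul_nonsing_inv _ (isUnit_iff_ne_zero.mpr hQ.det_pos.ne'),
    Matrix.one_mulVec]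

lemma normalPDF_inv {Q : Matrix (Fin p) (Fin p) ℝ} (hQ : Q.PosDef) (m x : Fin p → ℝ) :
    normalPDF m Q⁻¹ x = Real.sqrt (((2 * Real.pi) ^ p)⁻¹ * Q.det) *
      Real.exp (-(dotProduct (x - m) (Q.mulVec (x - m))) / 2) := by
  rw [normalPDF, Matrix.nonsing_inv_nonsing_inv _ (isUnit_iff_ne_zero.mpr hQ.det_pos.ne'),
    Matrix.det_nonsing_inv, Ring.inverse_eq_inv', ← Real.sqrt_inv, mul_inv, inv_inv]

variable (X) in
lemma dotProduct_gram_mulVec (lam : Fin n → ℝ) (β : Fin p → ℝ) :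
    dotProduct β ((X.transpose * Matrix.diagonal lam * X).mulVec β)
      = ∑ i, lam i * (X.mulVec β i) ^ 2 := by
  rw [← Matrix.mulVec_mulVec, ← Matrix.mulVec_mulVec, Matrix.dotProduct_mulVec,
    Matrix.vecMul_transpose, dotProduct]
  refine Finset.sum_congr rfl fun i _ => ?_
  rw [Matrix.mulVec_diagonal]; ring

variable (X) in
lemma dotProduct_cross_mulVec (lam z : Fin n → ℝ) (β : Fin p → ℝ) :
    dotProduct β ((X.transpose * Matrix.diagonal lam).mulVec z)
      = ∑ i, lam i * (X.mulVec β i * z i) := by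
  rw [← Matrix.mulVec_mulVec, Matrix.dotProduct_mulVec, Matrix.vecMul_transpose, dotProduct]
  refine Finset.sum_congr rfl fun i _ => ?_
  rw [Matrix.mulVec_diagonal]; ring

/-- The part of the exponent of the joint density that depends on the coefficients. -/
def jointForm (X : Matrix (Fin n) (Fin p) ℝ) (βa : Fin p → ℝ) (Sa : Matrix (Fin p) (Fin p) ℝ)
    (lam z : Fin n → ℝ) (β : Fin p → ℝ) : ℝ :=
  dotProduct (β - βa) (Sa.mulVec (β - βa)) + ∑ i, lam i * (z i - X.mulVec β i) ^ 2

/-- Completing the square. -/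
lemma sub_dotProduct_precision_mulVec_sub (hSa : Sa.PosDef) {lam : Fin n → ℝ}
    (hlam : ∀ i, 0 < lam i) (z : Fin n → ℝ) : ∃ c : ℝ, ∀ β : Fin p → ℝ,
      let Q := X.transpose * Matrix.diagonal lam * X + Sa
      let m := Q⁻¹.mulVec ((X.transpose * Matrix.diagonal lam).mulVec z + Sa.mulVec βa)
      dotProduct (β - m) (Q.mulVec (β - m)) = jointForm X βa Sa lam z β + c := by
  -- The constant is left open and read off by the final `rfl`: it is `mᵀQm - βaᵀ Sa βa - ∑ lamᵢ
  -- zᵢ²`.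
  refine ⟨?_, fun β => ?_⟩
  rotate_left
  · intro Q m
    have hQ : Q.PosDef := posDef_precision hSa hlam
    have hQm : Q.mulVec m = (X.transpose * Matrix.diagonal lam).mulVec z + Sa.mulVec βa :=
      mul_inv_mulVec hQ _
    rw [sub_dotProduct_mulVec_sub (transpose_eq_of_posDef hQ), hQm, jointForm,
      sub_dotProduct_mulVec_sub (transpose_eq_of_posDef hSa), dotProduct_add,
      dotProduct_cross_mulVec, Matrix.add_mulVec, dotProduct_add, dotProduct_gram_mulVec]
    have : ∑ i, lam i * (z i - X.mulVec β i) ^ 2 = ∑ i, lam i * (X.mulVec β i) ^ 2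
        - 2 * ∑ i, lam i * (X.mulVec β i * z i) + ∑ i, lam i * z i ^ 2 := by
      rw [Finset.mul_sum, ← Finset.sum_sub_distrib, ← Finset.sum_add_distrib]
      exact Finset.sum_congr rfl fun i _ => by ring
    rw [this, ← sub_eq_iff_eq_add']
    ring_nf
    rfl

lemma betaCondPDF_eq_exp_jointForm (hSa : Sa.PosDef) {lam : Fin n → ℝ}
    (hlam : ∀ i, 0 < lam i) (z : Fin n → ℝ) : ∃ d : ℝ, ∀ β : Fin p → ℝ,
      betaCondPDF X βa Sa lam z β = d * Real.exp (-jointForm X βa Sa lam z β / 2) := by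
  obtain ⟨c, hc⟩ := sub_dotProduct_precision_mulVec_sub (X := X) (βa := βa) hSa hlam z
  refine ⟨Real.sqrt (((2 * Real.pi) ^ p)⁻¹ * (X.transpose * Matrix.diagonal lam * X + Sa).det) *
    Real.exp (-c / 2), fun β => ?_⟩
  have := hc β
  simp only at this
  simp only [betaCondPDF]
  rw [normalPDF_inv (posDef_precision hSa hlam), this, mul_assoc, ← Real.exp_add]
  congr 2; ring

/-- The normal equations, arranged so that `z` enters only through the deviation from the
conditional mean and the weighted residuals. This is what makes the later estimate of `β` uniform in
`z`. -/
lemma precision_mulVec_sub (hSa : Sa.PosDef) {lam : Fin n → ℝ}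
    (hlam : ∀ i, 0 < lam i) (z : Fin n → ℝ) (β : Fin p → ℝ) :
      let Q := X.transpose * Matrix.diagonal lam * X + Sa
      let m := Q⁻¹.mulVec ((X.transpose * Matrix.diagonal lam).mulVec z + Sa.mulVec βa)
      Sa.mulVec (β - βa) = Q.mulVec (β - m) +
        X.transpose.mulVec (fun i => lam i * (z i - X.mulVec β i)) := by
  intro Q m
  have hQm : Q.mulVec m = (X.transpose * Matrix.diagonal lam).mulVec z + Sa.mulVec βa :=
    mul_inv_mulVec (posDef_precision hSa hlam) _
  have : (fun i => lam i * (z i - X.mulVec β i))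
      = (Matrix.diagonal lam).mulVec (z - X.mulVec β) := by
    ext i; rw [Matrix.mulVec_diagonal]; rfl
  rw [Matrix.mulVec_sub, Matrix.mulVec_sub, hQm, this, Matrix.mulVec_sub, Matrix.mulVec_sub,
    Matrix.add_mulVec]
  simp only [Matrix.mulVec_mulVec, Matrix.mul_assoc]
  abel

lemma exists_norm_mulVec_le {m k : ℕ} (A : Matrix (Fin m) (Fin k) ℝ) :
    ∃ c, 0 ≤ c ∧ ∀ v, ‖A.mulVec v‖ ≤ c * ‖v‖ := by
  refine ⟨‖LinearMap.toContinuousLinearMap (Matrix.toLin' A)‖, norm_nonneg _, fun v => ?_⟩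
  simpa using (LinearMap.toContinuousLinearMap (Matrix.toLin' A)).le_opNorm v

lemma exists_precision_le (X : Matrix (Fin n) (Fin p) ℝ) (Sa : Matrix (Fin p) (Fin p) ℝ) :
    ∃ c, 1 ≤ c ∧ ∀ (lam : Fin n → ℝ) (G : ℝ), 0 ≤ G → (∀ i, 0 ≤ lam i ∧ lam i ≤ G) → ∀ j k,
      |(X.transpose * Matrix.diagonal lam * X + Sa) j k| ≤ c * (1 + G) := by
  refine ⟨1 + ∑ j, ∑ k, ((∑ i, |X i j| * |X i k|) + |Sa j k|), ?_, ?_⟩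
  · have : 0 ≤ ∑ j, ∑ k, ((∑ i, |X i j| * |X i k|) + |Sa j k|) := by positivity
    linarith
  intro lam G hG hlam j k
  have h1 : (∑ i, |X i j| * |X i k|) + |Sa j k|
      ≤ ∑ j, ∑ k, ((∑ i, |X i j| * |X i k|) + |Sa j k|) :=
    (Finset.single_le_sum (f := fun k => (∑ i, |X i j| * |X i k|) + |Sa j k|)
      (fun _ _ => by positivity) (Finset.mem_univ k)).trans
    (Finset.single_le_sum (f := fun j => ∑ k, ((∑ i, |X i j| * |X i k|) + |Sa j k|))
      (fun _ _ => by positivity) (Finset.mem_univ j))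
  have h2 : |(X.transpose * Matrix.diagonal lam * X) j k| ≤ (∑ i, |X i j| * |X i k|) * G := by
    rw [Matrix.mul_apply, Finset.sum_mul]
    refine (Finset.abs_sum_le_sum_abs _ _).trans (Finset.sum_le_sum fun i _ => ?_)
    rw [Matrix.mul_diagonal, Matrix.transpose_apply, abs_mul, abs_mul, abs_of_nonneg (hlam i).1,
      mul_right_comm]
    exact mul_le_mul_of_nonneg_left (hlam i).2 (by positivity)
  have h3 : 0 ≤ ∑ i, |X i j| * |X i k| := by positivity
  have h4 := abs_nonneg (Sa j k)
  rw [Matrix.add_apply]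
  refine (abs_add_le _ _).trans ?_
  nlinarith [mul_nonneg h4 hG]

lemma pow_le_factorial_mul_exp {x : ℝ} (hx : 0 ≤ x) (N : ℕ) :
    x ^ N ≤ N.factorial * Real.exp x := by
  have := Real.pow_div_factorial_le_exp x hx N
  rwa [div_le_iff₀' (by positivity)] at this

/-- The normal full conditional of the coefficients, weighted by the Gamma full conditional of the
scale variables, decays uniformly in the latent variables. -/
theorem exists_betaCondPDF_le {ν : ℝ} (hν : 2 < ν) (X : Matrix (Fin n) (Fin p) ℝ)
    (βa : Fin p → ℝ) (hSa : Sa.PosDef) :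
    ∃ C : ℝ, 0 ≤ C ∧ ∀ (lam z : Fin n → ℝ) (β : Fin p → ℝ), (∀ i, 0 < lam i) →
      betaCondPDF X βa Sa lam z β ≤
        C * (∏ i, Real.exp ((ν + (z i - X.mulVec β i) ^ 2) / 2 * lam i / 2)) *
          (1 + ‖β‖) ^ (-((p : ℝ) + 1)) := by
  obtain ⟨c1, hc1, hQle⟩ := exists_precision_le X Sa
  obtain ⟨c2, hc2, hXle⟩ := exists_norm_mulVec_le X.transpose
  obtain ⟨κ, hκ, hSle⟩ := exists_norm_mulVec_le Sa⁻¹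
  set c3 : ℝ := 1 + ‖βa‖ + κ * (c1 + c2) with hc3
  set A : ℝ := (p.factorial : ℝ) * c1 ^ p with hA
  have hc3' : 0 ≤ c3 := by positivity
  have hA0 : 0 ≤ A := by positivity
  -- Powers of `1 + G`: `p` from the root of the determinant and `p + 1` from `(1 + ‖β‖) ^ (p + 1)`.
  set M := 2 * p + 1
  refine ⟨(1 + A) * c3 ^ (p + 1) * (M.factorial * 2 ^ M * Real.exp 2⁻¹) *
    ((p + 1).factorial * Real.exp (3 / 2)), by positivity, fun lam z β hlam => ?_⟩
  set b : Fin n → ℝ := fun i => (ν + (z i - X.mulVec β i) ^ 2) / 2 with hb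
  set G := ∑ i, b i * lam i with hG
  -- From `2 < ν`; it gives `lam i ≤ G`. The next bound, from `2|r| ≤ 1 + r²`, gives `lam i * |r| ≤
  -- G` for the residual `r`.
  have hb1 : ∀ i, 1 ≤ b i := fun i => by
    simp only [hb]; nlinarith [sq_nonneg (z i - X.mulVec β i)]
  have hbr : ∀ i, |z i - X.mulVec β i| ≤ b i := fun i => by
    simp only [hb]
    nlinarith [sq_abs (z i - X.mulVec β i), sq_nonneg (|z i - X.mulVec β i| - 1)]
  have hterm : ∀ i, 0 ≤ b i * lam i := fun i =>
    mul_nonneg (zero_le_one.trans (hb1 i)) (hlam i).le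
  have hG0 : 0 ≤ G := Finset.sum_nonneg fun i _ => hterm i
  have htermG : ∀ i, b i * lam i ≤ G := fun i =>
    Finset.single_le_sum (fun i _ => hterm i) (Finset.mem_univ i)
  have hlamG : ∀ i, 0 ≤ lam i ∧ lam i ≤ G := fun i =>
    ⟨(hlam i).le, le_trans (by nlinarith [hb1 i, hlam i]) (htermG i)⟩
  set Q := X.transpose * Matrix.diagonal lam * X + Sa with hQdef
  set m := Q⁻¹.mulVec ((X.transpose * Matrix.diagonal lam).mulVec z + Sa.mulVec βa) with hm
  have hQ : Q.PosDef := posDef_precision hSa hlam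
  set s := dotProduct (β - m) (Q.mulVec (β - m)) with hs
  have hs0 : 0 ≤ s := by
    simpa only [star_trivial] using hQ.posSemidef.dotProduct_mulVec_nonneg (β - m)
  have hQe : ‖Q.mulVec (β - m)‖ ≤ c1 * (1 + G) * (1 + Real.sqrt s) := by
    refine (pi_norm_le_iff_of_nonneg (by positivity)).mpr fun j => ?_
    have h1 := sq_mulVec_le hQ.posSemidef (β - m) j
    have h2 : Q j j ≤ c1 * (1 + G) := (le_abs_self _).trans (hQle lam G hG0 hlamG j j)
    -- Being at least `1`, this factor is below its own square, so the square root that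
    -- Cauchy–Schwarz would give can be avoided.
    have h3 : 1 ≤ c1 * (1 + G) := by nlinarith
    rw [Real.norm_eq_abs]
    refine abs_le_of_sq_le_sq ?_ (by positivity)
    have h4 : Q j j * s ≤ c1 * (1 + G) * s := mul_le_mul_of_nonneg_right h2 hs0
    have h5 : s ≤ (1 + Real.sqrt s) ^ 2 := by
      nlinarith [Real.sq_sqrt hs0, Real.sqrt_nonneg s]
    have h6 : c1 * (1 + G) ≤ (c1 * (1 + G)) ^ 2 := by nlinarith
    calc _ ≤ c1 * (1 + G) * s := h1.trans h4
      _ ≤ (c1 * (1 + G)) ^ 2 * (1 + Real.sqrt s) ^ 2 := by gcongr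
      _ = _ := by ring
  have hXr : ‖X.transpose.mulVec (fun i => lam i * (z i - X.mulVec β i))‖ ≤ c2 * G := by
    refine (hXle _).trans (mul_le_mul_of_nonneg_left ?_ hc2)
    refine (pi_norm_le_iff_of_nonneg hG0).mpr fun i => ?_
    rw [Real.norm_eq_abs, abs_mul, abs_of_pos (hlam i)]
    refine le_trans ?_ (htermG i)
    rw [mul_comm]
    exact mul_le_mul_of_nonneg_right (hbr i) (hlam i).le
  -- Apply `Sa⁻¹` to the normal equations and absorb every term into the single product `(1 + G) *
  -- (1 + √s)`.
  have hβ : 1 + ‖β‖ ≤ c3 * ((1 + G) * (1 + Real.sqrt s)) := by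
    have h1 : ‖β - βa‖ ≤ κ * (c1 * (1 + G) * (1 + Real.sqrt s) + c2 * G) := by
      have h2 := hSle (Sa.mulVec (β - βa))
      rw [Matrix.mulVec_mulVec, Matrix.nonsing_inv_mul _
        (isUnit_iff_ne_zero.mpr hSa.det_pos.ne'), Matrix.one_mulVec] at h2
      refine h2.trans (mul_le_mul_of_nonneg_left ?_ hκ)
      rw [precision_mulVec_sub (βa := βa) hSa hlam z β]
      exact (norm_add_le _ _).trans (add_le_add hQe hXr)
    have h2 : ‖β‖ ≤ ‖β - βa‖ + ‖βa‖ := by simpa using norm_add_le (β - βa) βa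
    set u := (1 + G) * (1 + Real.sqrt s) with hu
    have h3 : 1 ≤ u := by nlinarith [Real.sqrt_nonneg s]
    have h4 : G ≤ u := by nlinarith [Real.sqrt_nonneg s]
    have h5 : κ * (c1 * (1 + G) * (1 + Real.sqrt s) + c2 * G) ≤ κ * (c1 + c2) * u := by
      rw [mul_assoc κ, mul_assoc c1, ← hu]
      refine mul_le_mul_of_nonneg_left ?_ hκ
      rw [add_mul]
      gcongr
    have h6 : 1 + ‖βa‖ ≤ (1 + ‖βa‖) * u := le_mul_of_one_le_right (by positivity) h3
    rw [hc3, add_mul]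
    linarith
  have hdet : Q.det ≤ A * (1 + G) ^ p := by
    have h := Matrix.det_le (A := Q) (abv := AbsoluteValue.abs) (x := c1 * (1 + G))
      (hQle lam G hG0 hlamG)
    simp only [Fintype.card_fin, nsmul_eq_mul, mul_pow] at h
    rw [hA, mul_assoc]
    exact (le_abs_self _).trans h
  have hsqrt : Real.sqrt (((2 * Real.pi) ^ p)⁻¹ * Q.det) ≤ (1 + A) * (1 + G) ^ p := by
    have h1 : ((2 * Real.pi) ^ p)⁻¹ ≤ 1 :=
      inv_le_one_of_one_le₀ (one_le_pow₀ (by nlinarith [Real.pi_gt_three]))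
    have h2 : (1 : ℝ) ≤ (1 + G) ^ p := one_le_pow₀ (by linarith)
    -- The summand `1` in `1 + A` makes the bound at least `1`, hence at most its square, so no
    -- half-integer powers appear.
    refine Real.sqrt_le_iff.mpr ⟨by positivity, ?_⟩
    calc _ ≤ 1 * Q.det := mul_le_mul_of_nonneg_right h1 hQ.det_pos.le
      _ ≤ (1 + A) * (1 + G) ^ p := by nlinarith
      _ ≤ ((1 + A) * (1 + G) ^ p) ^ 2 := by
        refine le_self_pow₀ ?_ two_ne_zero
        nlinarith
  -- `x ^ M ≤ M! exp x` is used at `x = (1 + G) / 2`, so that the exponential cost is exactly `exp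
  -- (G / 2)`.
  have hGexp : (1 + G) ^ M ≤ M.factorial * 2 ^ M * Real.exp 2⁻¹ * Real.exp (G / 2) := by
    have h := pow_le_factorial_mul_exp (x := (1 + G) / 2) (by positivity) M
    rw [div_pow, div_le_iff₀ (by positivity)] at h
    refine h.trans (le_of_eq ?_)
    rw [show (1 + G) / 2 = 2⁻¹ + G / 2 by ring, Real.exp_add]; ring
  have hsexp : (1 + Real.sqrt s) ^ (p + 1) * Real.exp (-s / 2) ≤
      (p + 1).factorial * Real.exp (3 / 2) := by
    have h := pow_le_factorial_mul_exp (x := 1 + Real.sqrt s) (by positivity) (p + 1)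
    -- The slope `1/2` in `s` is chosen to cancel against the Gaussian factor `exp (-s / 2)`.
    have h1 : 1 + Real.sqrt s ≤ 3 / 2 + s / 2 := by
      nlinarith [Real.sq_sqrt hs0, sq_nonneg (Real.sqrt s - 1)]
    calc _ ≤ (p + 1).factorial * Real.exp (3 / 2 + s / 2) * Real.exp (-s / 2) := by
          gcongr; exact h.trans (by gcongr)
      _ = _ := by rw [mul_assoc, ← Real.exp_add]; congr 2; ring
  have hprod : ∏ i, Real.exp (b i * lam i / 2) = Real.exp (G / 2) := by
    rw [← Real.exp_sum, hG, Finset.sum_div]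
  rw [hprod, Real.rpow_neg (by positivity), ← div_eq_mul_inv, le_div_iff₀ (by positivity),
    show ((p : ℝ) + 1) = ((p + 1 : ℕ) : ℝ) by push_cast; rfl, Real.rpow_natCast]
  simp only [betaCondPDF]
  rw [normalPDF_inv hQ]
  calc _ ≤ (1 + A) * (1 + G) ^ p * Real.exp (-s / 2) *
        (c3 * ((1 + G) * (1 + Real.sqrt s))) ^ (p + 1) := by gcongr
    _ = (1 + A) * c3 ^ (p + 1) * (1 + G) ^ M *
        ((1 + Real.sqrt s) ^ (p + 1) * Real.exp (-s / 2)) := by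
        rw [mul_pow, mul_pow, show M = p + (p + 1) by omega, pow_add (1 + G) p]; ring
    _ ≤ (1 + A) * c3 ^ (p + 1) * (M.factorial * 2 ^ M * Real.exp 2⁻¹ * Real.exp (G / 2)) *
        ((p + 1).factorial * Real.exp (3 / 2)) := by gcongr
    _ = _ := by ring

end BetaCond

/-! ### Hilbert–Schmidt integral operators and two-step Markov operators -/

section KernelOperator

variable {E T : Type*} [MeasurableSpace E] [MeasurableSpace T] {μ : Measure E} {ρ : Measure T}
  [SFinite μ] [SFinite ρ] {D : E → T → ℝ}

-- The tensor product of `f` and `g` is square integrable, so Hölder applies against `D`. Every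
-- later use of Fubini rests on this.
omit [SFinite μ] [SFinite ρ] in
lemma integrable_mul_kernel_mul (hL2 : MemLp (Function.uncurry D) 2 (μ.prod ρ)) {f : E → ℝ}
    {g : T → ℝ} (hf : MemLp f 2 μ) (hg : MemLp g 2 ρ) :
    Integrable (fun q : E × T => f q.1 * D q.1 q.2 * g q.2) (μ.prod ρ) := by
  have hfg : MemLp (fun q : E × T => f q.1 * g q.2) 2 (μ.prod ρ) := by
    have hm : AEStronglyMeasurable (fun q : E × T => f q.1 * g q.2) (μ.prod ρ) :=
      hf.1.comp_fst.mul hg.1.comp_snd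
    rw [memLp_two_iff_integrable_sq hm]
    simp only [mul_pow]
    exact hf.integrable_sq.mul_prod hg.integrable_sq
  refine (hfg.integrable_mul hL2).congr (ae_of_all _ fun q => ?_)
  simp only [Pi.mul_apply, Function.uncurry]
  ring

lemma integrable_integral_sq_kernel (hL2 : MemLp (Function.uncurry D) 2 (μ.prod ρ)) :
    Integrable (fun t => ∫ x, D x t ^ 2 ∂μ) ρ :=
  hL2.integrable_sq.integral_prod_right

lemma ae_memLp_kernel (hD : Measurable (Function.uncurry D))
    (hL2 : MemLp (Function.uncurry D) 2 (μ.prod ρ)) :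
    ∀ᵐ t ∂ρ, MemLp (fun x => D x t) 2 μ := by
  filter_upwards [hL2.integrable_sq.prod_left_ae] with t ht
  have hm : AEStronglyMeasurable (fun x => D x t) μ :=
    (hD.comp measurable_prodMk_right).aestronglyMeasurable
  rw [memLp_two_iff_integrable_sq hm]
  exact ht

omit [SFinite μ] in
lemma integral_mul_eq_inner (f : Lp ℝ 2 μ) {d : E → ℝ} (hd : MemLp d 2 μ) :
    ∫ x, f x * d x ∂μ = inner ℝ f hd.toLp := by
  rw [L2.inner_def]
  refine integral_congr_ae ?_
  filter_upwards [hd.coeFn_toLp] with x hx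
  simp [hx, mul_comm]

omit [SFinite μ] in
lemma norm_toLp_sq {d : E → ℝ} (hd : MemLp d 2 μ) : ‖hd.toLp‖ ^ 2 = ∫ x, d x ^ 2 ∂μ := by
  rw [← real_inner_self_eq_norm_sq, ← integral_mul_eq_inner]
  refine integral_congr_ae ?_
  filter_upwards [hd.coeFn_toLp] with x hx
  simp [hx, sq]

omit [SFinite μ] in
lemma sum_sq_integral_mul_kernel_le {ι : Type*} (s : Finset ι) {e : ι → Lp ℝ 2 μ}
    (he : Orthonormal ℝ e) {d : E → ℝ} (hd : MemLp d 2 μ) :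
    ∑ i ∈ s, (∫ x, e i x * d x ∂μ) ^ 2 ≤ ∫ x, d x ^ 2 ∂μ := by
  rw [← norm_toLp_sq hd]
  simp only [integral_mul_eq_inner _ hd]
  simpa using he.sum_inner_products_le hd.toLp (s := s)

omit [SFinite μ] in
lemma sq_integral_mul_le (f : Lp ℝ 2 μ) {d : E → ℝ} (hd : MemLp d 2 μ) :
    (∫ x, f x * d x ∂μ) ^ 2 ≤ ‖f‖ ^ 2 * ∫ x, d x ^ 2 ∂μ := by
  rw [← norm_toLp_sq hd, integral_mul_eq_inner _ hd, ← mul_pow, ← sq_abs]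
  exact pow_le_pow_left₀ (abs_nonneg _) (abs_real_inner_le_norm _ _) 2

lemma memLp_integral_mul_kernel (hD : Measurable (Function.uncurry D))
    (hL2 : MemLp (Function.uncurry D) 2 (μ.prod ρ)) (f : Lp ℝ 2 μ) :
    MemLp (fun t => ∫ x, f x * D x t ∂μ) 2 ρ := by
  have hm : AEStronglyMeasurable (fun t => ∫ x, f x * D x t ∂μ) ρ := by
    refine StronglyMeasurable.aestronglyMeasurable ?_
    refine StronglyMeasurable.integral_prod_left' (f := fun q : E × T => f q.1 * D q.1 q.2) ?_
    exact ((Lp.stronglyMeasurable f).comp_measurable measurable_fst).mul hD.stronglyMeasurable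
  rw [memLp_two_iff_integrable_sq hm]
  refine ((integrable_integral_sq_kernel hL2).const_mul (‖f‖ ^ 2)).mono' (hm.pow 2) ?_
  filter_upwards [ae_memLp_kernel hD hL2] with t ht
  rw [Real.norm_of_nonneg (sq_nonneg _)]
  exact sq_integral_mul_le f ht

/-- A square integrable kernel defines a bounded operator between the `L²` spaces. -/
lemma exists_kernelOperator (hD : Measurable (Function.uncurry D))
    (hL2 : MemLp (Function.uncurry D) 2 (μ.prod ρ)) :
    ∃ A : Lp ℝ 2 μ →L[ℝ] Lp ℝ 2 ρ, ∀ f : Lp ℝ 2 μ, A f =ᵐ[ρ] fun t => ∫ x, f x * D x t ∂μ := by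
  let A : Lp ℝ 2 μ →ₗ[ℝ] Lp ℝ 2 ρ :=
    { toFun := fun f => (memLp_integral_mul_kernel hD hL2 f).toLp
      map_add' := fun f g => by
        rw [← MemLp.toLp_add]
        refine MemLp.toLp_congr _ _ ?_
        filter_upwards [ae_memLp_kernel hD hL2] with t ht
        simp only [Pi.add_apply, integral_mul_eq_inner _ ht, inner_add_left]
      map_smul' := fun c f => by
        rw [RingHom.id_apply, ← MemLp.toLp_const_smul]
        refine MemLp.toLp_congr _ _ ?_
        filter_upwards [ae_memLp_kernel hD hL2] with t ht
        simp only [Pi.smul_apply, integral_mul_eq_inner _ ht, real_inner_smul_left, smul_eq_mul] }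
  have hA : ∀ f : Lp ℝ 2 μ, A f =ᵐ[ρ] fun t => ∫ x, f x * D x t ∂μ := fun f =>
    MemLp.coeFn_toLp (memLp_integral_mul_kernel hD hL2 f)
  -- The operator norm is bounded by the Hilbert–Schmidt norm, through Cauchy–Schwarz for almost
  -- every `t`.
  refine ⟨A.mkContinuous (Real.sqrt (∫ t, ∫ x, D x t ^ 2 ∂μ ∂ρ)) fun f => ?_, hA⟩
  refine abs_le_of_sq_le_sq' ?_ (by positivity) |>.2
  rw [mul_pow, Real.sq_sqrt (integral_nonneg fun t => integral_nonneg fun x => sq_nonneg _),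
    show A f = (memLp_integral_mul_kernel hD hL2 f).toLp from rfl, norm_toLp_sq, mul_comm,
    ← integral_const_mul]
  refine integral_mono_ae (memLp_integral_mul_kernel hD hL2 f).integrable_sq
    ((integrable_integral_sq_kernel hL2).const_mul _) ?_
  filter_upwards [ae_memLp_kernel hD hL2] with t ht
  exact sq_integral_mul_le f ht

/-- Seeing the mixture as a first marginal moves integrals against it to the product space, where
integrability of one function of the pair suffices. -/
lemma withDensity_lintegral_eq_map_fst {F : E → T → ENNReal} (hF : Measurable (Function.uncurry F)) :
    μ.withDensity (fun x => ∫⁻ t, F x t ∂ρ)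
      = ((μ.prod ρ).withDensity (Function.uncurry F)).map Prod.fst := by
  ext s hs
  rw [Measure.map_apply measurable_fst hs, withDensity_apply _ hs,
    withDensity_apply _ (measurable_fst hs), ← Set.prod_univ, ← Measure.prod_restrict,
    Measure.restrict_univ, lintegral_prod _ hF.aemeasurable]
  rfl

/-- With `d = D x` this is one step of the chain from `x`: the average of `f` over the new state
equals `A f` integrated against `D x`. -/
lemma integrable_integral_withDensity_kernel (hD : Measurable (Function.uncurry D))
    (hL2 : MemLp (Function.uncurry D) 2 (μ.prod ρ)) (hnn : ∀ x t, 0 ≤ D x t) (f : Lp ℝ 2 μ)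
    {d : T → ℝ} (hd : Measurable d) (hd0 : ∀ t, 0 ≤ d t) (hd2 : MemLp d 2 ρ) :
    Integrable f (μ.withDensity fun x => ∫⁻ t, ENNReal.ofReal (D x t * d t) ∂ρ) ∧
      ∫ x, f x ∂(μ.withDensity fun x => ∫⁻ t, ENNReal.ofReal (D x t * d t) ∂ρ)
        = ∫ t, (∫ x, f x * D x t ∂μ) * d t ∂ρ := by
  have hF : Measurable (Function.uncurry fun x t => ENNReal.ofReal (D x t * d t)) :=
    (hD.mul (hd.comp measurable_snd)).ennreal_ofReal
  have hf := Lp.stronglyMeasurable f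
  have hint := integrable_mul_kernel_mul hL2 (Lp.memLp f) hd2
  have hfin : ∀ᵐ q ∂(μ.prod ρ),
      Function.uncurry (fun x t => ENNReal.ofReal (D x t * d t)) q < ⊤ :=
    ae_of_all _ fun q => ENNReal.ofReal_lt_top
  have hpt : ∀ q : E × T, (Function.uncurry (fun x t => ENNReal.ofReal (D x t * d t)) q).toReal •
      f q.1 = f q.1 * D q.1 q.2 * d q.2 := fun q => by
    simp only [Function.uncurry, smul_eq_mul]
    rw [ENNReal.toReal_ofReal (mul_nonneg (hnn _ _) (hd0 _))]
    ring
  rw [withDensity_lintegral_eq_map_fst hF]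
  constructor
  · rw [integrable_map_measure hf.aestronglyMeasurable measurable_fst.aemeasurable,
      integrable_withDensity_iff_integrable_smul' hF hfin]
    exact hint.congr (ae_of_all _ fun q => (hpt q).symm)
  · rw [integral_map measurable_fst.aemeasurable hf.aestronglyMeasurable,
      integral_withDensity_eq_integral_toReal_smul hF hfin]
    simp_rw [hpt]
    rw [integral_prod_symm _ hint]
    simp_rw [integral_mul_const]

end KernelOperator

/-! ### Trace class Markov operators from square integrable kernels -/

section MarkovOperator

variable {E T : Type*} [MeasurableSpace E] [MeasurableSpace T] {μ : Measure E} {ρ : Measure T}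
  [IsFiniteMeasure μ] [IsFiniteMeasure ρ] {D : E → T → ℝ}

/-- The Markov operator of a chain that moves through an auxiliary variable `t`, where `D` is the
density of the joint law of the two variables with respect to the product of its marginals: if `D`
is square integrable, then the operator is positive and trace class. -/
theorem exists_positive_isTraceClass_markovOperator (hD : Measurable (Function.uncurry D))
    (hL2 : MemLp (Function.uncurry D) 2 (μ.prod ρ)) (hnn : ∀ x t, 0 ≤ D x t)
    (hμ : ∀ᵐ t ∂ρ, ∫ x, D x t ∂μ = 1) (hρ : ∀ᵐ x ∂μ, ∫ t, D x t ∂ρ = 1) {P : E → Measure E}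
    (hP : ∀ x, P x = μ.withDensity fun x' => ∫⁻ t, ENNReal.ofReal (D x' t * D x t) ∂ρ) :
    ∃ K : meanZeroL2 μ →L[ℝ] meanZeroL2 μ,
      IsMarkovOperator P μ K ∧ K.IsPositive ∧ IsTraceClass K := by
  have hD' : Measurable (Function.uncurry fun t x => D x t) := hD.comp measurable_swap
  have hL2' : MemLp (Function.uncurry fun t x => D x t) 2 (ρ.prod μ) :=
    hL2.comp_measurePreserving Measure.measurePreserving_swap
  obtain ⟨A, hA⟩ := exists_kernelOperator hD hL2
  obtain ⟨B, hB⟩ := exists_kernelOperator hD' hL2'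
  have hBA : ∀ (f : Lp ℝ 2 μ) x, ∫ t, A f t * D x t ∂ρ = ∫ t, (∫ x', f x' * D x' t ∂μ) * D x t ∂ρ :=
    fun f x => integral_congr_ae (by filter_upwards [hA f] with t ht; rw [ht])
  have hswap : ∀ {f : E → ℝ} {g : T → ℝ}, MemLp f 2 μ → MemLp g 2 ρ →
      ∫ t, (∫ x, f x * D x t ∂μ) * g t ∂ρ = ∫ x, f x * ∫ t, g t * D x t ∂ρ ∂μ := by
    intro f g hf hg
    have hint := integrable_mul_kernel_mul hL2 hf hg
    have h := integral_integral_swap (f := fun x t => f x * D x t * g t) hint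
    simp_rw [← integral_mul_const, ← integral_const_mul]
    rw [← h]
    simp_rw [mul_assoc, mul_comm (g _)]
  have hadj : ∀ (f : Lp ℝ 2 μ) (g : Lp ℝ 2 ρ), inner ℝ (A f) g = inner ℝ f (B g) := by
    intro f g
    rw [L2.inner_def, L2.inner_def]
    have h1 : ∫ t, inner ℝ (A f t) (g t) ∂ρ = ∫ t, (∫ x, f x * D x t ∂μ) * g t ∂ρ := by
      refine integral_congr_ae ?_
      filter_upwards [hA f] with t ht
      simp [ht, mul_comm]
    have h2 : ∫ x, inner ℝ (f x) (B g x) ∂μ = ∫ x, f x * ∫ t, g t * D x t ∂ρ ∂μ := by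
      refine integral_congr_ae ?_
      filter_upwards [hB g] with x hx
      simp [hx, mul_comm]
    rw [h1, h2, hswap (Lp.memLp f) (Lp.memLp g)]
  -- Both marginal conditions enter: that on `μ` shows that `B` preserves integrals, that on `ρ`
  -- shows the same for `A`.
  have hmean : ∀ f : meanZeroL2 μ, B (A f) ∈ meanZeroL2 μ := by
    intro f
    have hf : ∫ x, (f : Lp ℝ 2 μ) x ∂μ = 0 := f.2
    change ∫ x, B (A f) x ∂μ = 0
    have h1 := hswap (memLp_const (1 : ℝ)) (Lp.memLp (A (f : Lp ℝ 2 μ)))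
    have h2 := hswap (Lp.memLp (f : Lp ℝ 2 μ)) (memLp_const (1 : ℝ))
    simp only [one_mul, mul_one] at h1 h2
    rw [integral_congr_ae (hB _), ← h1]
    calc ∫ t, (∫ x, D x t ∂μ) * A (f : Lp ℝ 2 μ) t ∂ρ
        = ∫ t, ∫ x, (f : Lp ℝ 2 μ) x * D x t ∂μ ∂ρ := by
          refine integral_congr_ae ?_
          filter_upwards [hμ, hA f] with t h h'
          rw [h, one_mul, h']
      _ = ∫ x, (f : Lp ℝ 2 μ) x ∂μ := by
          rw [h2]
          refine integral_congr_ae ?_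
          filter_upwards [hρ] with x h
          rw [h, mul_one]
      _ = 0 := hf
  let K : meanZeroL2 μ →L[ℝ] meanZeroL2 μ :=
    ((B.comp A).comp (meanZeroL2 μ).subtypeL).codRestrict (meanZeroL2 μ) hmean
  have hK : ∀ f g : meanZeroL2 μ, inner ℝ (K f) g = inner ℝ (A f) (A g) := by
    intro f g
    change inner ℝ (B (A (f : Lp ℝ 2 μ))) (g : Lp ℝ 2 μ) = _
    rw [real_inner_comm, ← hadj, real_inner_comm]
  have hpos : K.IsPositive := by
    refine ⟨fun f g => ?_, fun f => ?_⟩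
    · change inner ℝ (K f) g = inner ℝ f (K g)
      rw [hK, real_inner_comm, ← hK, real_inner_comm]
    · change 0 ≤ inner ℝ (K f) f
      rw [hK]
      exact real_inner_self_nonneg
  -- As `K` is positive, it is its own absolute value.
  refine ⟨K, fun f => ?_, hpos, K, hpos, ?_, fun w b => ?_⟩
  · filter_upwards [hB (A f), ae_memLp_kernel hD' hL2'] with x hx hdx
    have h := integrable_integral_withDensity_kernel hD hL2 hnn (f : Lp ℝ 2 μ)
      (d := D x) (hD.comp measurable_prodMk_left) (hnn x) hdx
    rw [hP x]
    refine ⟨h.1, ?_⟩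
    rw [h.2, ← hBA]
    exact hx
  · rw [(ContinuousLinearMap.isSelfAdjoint_iff'.mp hpos.isSelfAdjoint)]
  · have he : Orthonormal ℝ fun i : w => ((b i : meanZeroL2 μ) : Lp ℝ 2 μ) :=
      b.orthonormal.comp_linearIsometry (meanZeroL2 μ).subtypeₗᵢ
    refine summable_of_sum_le (c := ∫ t, ∫ x, D x t ^ 2 ∂μ ∂ρ) (fun i => ?_) fun s => ?_
    · rw [hK]; exact real_inner_self_nonneg
    have hm := fun i => memLp_integral_mul_kernel hD hL2 (b i : Lp ℝ 2 μ)
    have h1 : ∀ i, inner ℝ (K (b i)) (b i)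
        = ∫ t, (∫ x, (b i : Lp ℝ 2 μ) x * D x t ∂μ) ^ 2 ∂ρ := by
      intro i
      rw [hK, real_inner_self_eq_norm_sq, ← norm_toLp_sq (hm i),
        show A (b i : Lp ℝ 2 μ) = (hm i).toLp from Lp.ext ((hA _).trans (hm i).coeFn_toLp.symm)]
    -- The partial traces are bounded by Bessel's inequality for `D · t` at almost every `t`,
    -- integrated over `t`.
    simp only [h1]
    rw [← integral_finsetSum _ fun i _ => (hm i).integrable_sq]
    refine integral_mono_ae (integrable_finsetSum _ fun i _ => (hm i).integrable_sq)
      (integrable_integral_sq_kernel hL2) ?_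
    filter_upwards [ae_memLp_kernel hD hL2] with t ht
    exact sum_sq_integral_mul_kernel_le s he ht

end MarkovOperator

/-! ### Detailed balance and the integral over the diagonal -/

section DataAugmentation

variable {E T : Type*} [MeasurableSpace E] [MeasurableSpace T]

/-- The data augmentation chain that draws `t` from the density `h x` and then `x'` from the density
`b · t`, for the target density `u`: the chain has a positive trace class Markov operator as soon
as its transition density is integrable on the diagonal. -/
theorem exists_positive_isTraceClass_dataAugmentation {vol : Measure E} {τ : Measure T}
    [SFinite vol] [SFinite τ] {u : E → ℝ} {b h : E → T → ℝ} {w : T → ℝ}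
    (hu : Measurable u) (hb : Measurable (Function.uncurry b))
    (hw : Measurable w) (hu0 : ∀ x, 0 < u x) (hb0 : ∀ x t, 0 ≤ b x t) (hw0 : ∀ t, 0 ≤ w t)
    (hbal : ∀ᵐ t ∂τ, ∀ x, u x * h x t = w t * b x t)
    (hb1 : ∀ᵐ t ∂τ, ∫⁻ x, ENNReal.ofReal (b x t) ∂vol = 1)
    (hh1 : ∀ x, ∫⁻ t, ENNReal.ofReal (h x t) ∂τ = 1)
    (hdiag : ∫⁻ x, ∫⁻ t, ENNReal.ofReal (b x t * h x t) ∂τ ∂vol < ⊤)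
    (μ : Measure E) [IsFiniteMeasure μ]
    (hμ : μ = vol.withDensity fun x => ENNReal.ofReal (u x)) {P : E → Measure E}
    (hP : ∀ x, P x = vol.withDensity fun x' => ∫⁻ t, ENNReal.ofReal (b x' t * h x t) ∂τ) :
    ∃ K : meanZeroL2 μ →L[ℝ] meanZeroL2 μ,
      IsMarkovOperator P μ K ∧ K.IsPositive ∧ IsTraceClass K := by
  let ρ := τ.withDensity fun t => ENNReal.ofReal (w t)
  let D : E → T → ℝ := fun x t => b x t / u x
  have hD : Measurable (Function.uncurry D) := hb.div (hu.comp measurable_fst)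
  have hnn : ∀ x t, 0 ≤ D x t := fun x t => div_nonneg (hb0 x t) (hu0 x).le
  have hDx : ∀ x, Measurable fun t => D x t := fun x => hD.comp measurable_prodMk_left
  have hDt : ∀ t, Measurable fun x => D x t := fun t => hD.comp measurable_prodMk_right
  have hlμ : ∀ {g : E → ENNReal}, Measurable g →
      ∫⁻ x, g x ∂μ = ∫⁻ x, ENNReal.ofReal (u x) * g x ∂vol := fun hg => by
    rw [hμ, lintegral_withDensity_eq_lintegral_mul _ hu.ennreal_ofReal hg]; rfl
  have hlρ : ∀ {g : T → ENNReal}, Measurable g →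
      ∫⁻ t, g t ∂ρ = ∫⁻ t, ENNReal.ofReal (w t) * g t ∂τ := fun hg => by
    rw [lintegral_withDensity_eq_lintegral_mul _ hw.ennreal_ofReal hg]; rfl
  have hρfin : IsFiniteMeasure ρ := by
    refine ⟨?_⟩
    rw [← lintegral_one, hlρ measurable_const]
    -- Integrating the balance relation over both variables shows that `ρ` has the mass of `μ`.
    calc ∫⁻ t, ENNReal.ofReal (w t) * 1 ∂τ
        = ∫⁻ t, ∫⁻ x, ENNReal.ofReal (w t) * ENNReal.ofReal (b x t) ∂vol ∂τ := by
          refine lintegral_congr_ae ?_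
          filter_upwards [hb1] with t ht
          rw [lintegral_const_mul' _ _ ENNReal.ofReal_ne_top, ht]
      _ = ∫⁻ x, ∫⁻ t, ENNReal.ofReal (w t) * ENNReal.ofReal (b x t) ∂τ ∂vol :=
          lintegral_lintegral_swap ((hw.comp measurable_fst).ennreal_ofReal.mul
            (hb.comp measurable_swap).ennreal_ofReal).aemeasurable
      _ = ∫⁻ x, ENNReal.ofReal (u x) * 1 ∂vol := by
          refine lintegral_congr fun x => ?_
          rw [← hh1 x, ← lintegral_const_mul' _ _ ENNReal.ofReal_ne_top]
          refine lintegral_congr_ae ?_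
          filter_upwards [hbal] with t ht
          rw [← ENNReal.ofReal_mul (hw0 t), ← ENNReal.ofReal_mul (hu0 x).le, ht]
      _ = μ Set.univ := by rw [← lintegral_one, hlμ measurable_const]
      _ < ⊤ := measure_lt_top _ _
  have hh : ∀ᵐ t ∂τ, ∀ x, h x t = w t * b x t / u x := by
    filter_upwards [hbal] with t ht x
    rw [eq_div_iff (hu0 x).ne', ← ht x]; ring
  -- Since `h = w b / u`, the weighted square `u w D²` is `b h`: the squared `L²` norm is the
  -- diagonal integral itself.
  have hL2 : MemLp (Function.uncurry D) 2 (μ.prod ρ) := by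
    have hsq : Measurable fun q : E × T => Function.uncurry D q ^ 2 := hD.pow_const 2
    rw [memLp_two_iff_integrable_sq hD.aestronglyMeasurable,
      ← lintegral_ofReal_ne_top_iff_integrable hsq.aestronglyMeasurable
        (ae_of_all _ fun q => sq_nonneg _),
      lintegral_prod _ hsq.ennreal_ofReal.aemeasurable,
      hlμ hsq.ennreal_ofReal.lintegral_prod_right']
    refine ne_of_lt (lt_of_le_of_lt (le_of_eq ?_) hdiag)
    refine lintegral_congr fun x => ?_
    simp only [Function.uncurry]
    rw [hlρ ((hDx x).pow_const 2).ennreal_ofReal, ← lintegral_const_mul' _ _ ENNReal.ofReal_ne_top]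
    refine lintegral_congr_ae ?_
    filter_upwards [hh] with t ht
    rw [← ENNReal.ofReal_mul (hw0 t), ← ENNReal.ofReal_mul (hu0 x).le, ht x]
    congr 1
    have := (hu0 x).ne'
    simp only [D]
    field_simp
  refine exists_positive_isTraceClass_markovOperator (μ := μ) (ρ := ρ) hD hL2 hnn ?_
    (ae_of_all _ fun x => ?_) fun x => ?_
  · refine (withDensity_absolutelyContinuous _ _).ae_le ?_
    filter_upwards [hb1] with t ht
    rw [integral_eq_lintegral_of_nonneg_ae (ae_of_all _ fun x => hnn x t)
      (hDt t).aestronglyMeasurable, hlμ (hDt t).ennreal_ofReal]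
    simp_rw [← ENNReal.ofReal_mul (hu0 _).le]
    rw [← ENNReal.toReal_one, ← ht]
    congr 1
    refine lintegral_congr fun x => ?_
    rw [mul_div_cancel₀ _ (hu0 x).ne']
  · rw [integral_eq_lintegral_of_nonneg_ae (ae_of_all _ fun t => hnn x t)
      (hDx x).aestronglyMeasurable, hlρ (hDx x).ennreal_ofReal, ← ENNReal.toReal_one, ← hh1 x]
    congr 1
    refine lintegral_congr_ae ?_
    filter_upwards [hh] with t ht
    rw [← ENNReal.ofReal_mul (hw0 t), ht x, mul_div_assoc]
  · have hF : Measurable (Function.uncurry fun x' t => ENNReal.ofReal (D x' t * D x t)) :=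
      (hD.mul ((hDx x).comp measurable_snd)).ennreal_ofReal
    have hF' : Measurable fun x' => ∫⁻ t, ENNReal.ofReal (D x' t * D x t) ∂ρ :=
      hF.lintegral_prod_right'
    rw [hP x, hμ, ← withDensity_mul _ hu.ennreal_ofReal hF']
    congr 1
    ext x'
    have hx' : Measurable fun t => ENNReal.ofReal (D x' t * D x t) :=
      ((hDx x').mul (hDx x)).ennreal_ofReal
    rw [Pi.mul_apply, hlρ hx', ← lintegral_const_mul' _ _ ENNReal.ofReal_ne_top]
    refine lintegral_congr_ae ?_
    filter_upwards [hh] with t ht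
    rw [← ENNReal.ofReal_mul (hw0 t), ← ENNReal.ofReal_mul (hu0 x').le, ht x]
    congr 1
    have := (hu0 x').ne'
    have := (hu0 x).ne'
    simp only [D]
    field_simp

end DataAugmentation

/-! ### The robit data augmentation chain -/

section Model

variable {n p : ℕ} {ν : ℝ} {X : Matrix (Fin n) (Fin p) ℝ} {y : Fin n → Bool}
  {βa : Fin p → ℝ} {Sa : Matrix (Fin p) (Fin p) ℝ}

lemma measurable_integral_halfLine_studentPDF (ν : ℝ) (y : Bool) :
    Measurable fun μ => ∫ t in halfLine y, studentPDF ν μ t :=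
  (measurable_studentPDF ν).stronglyMeasurable.integral_prod_right'.measurable

lemma measurable_truncStudentPDF (ν : ℝ) (y : Bool) :
    Measurable fun q : ℝ × ℝ => truncStudentPDF ν q.1 y q.2 := by
  have h : Measurable ((Prod.snd ⁻¹' halfLine y : Set (ℝ × ℝ)).indicator
      fun q : ℝ × ℝ => studentPDF ν q.1 q.2) :=
    (measurable_studentPDF ν).indicator (measurable_snd (measurableSet_halfLine y))
  exact h.div ((measurable_integral_halfLine_studentPDF ν y).comp measurable_fst)

lemma truncStudentPDF_nonneg (hν : 0 < ν) (μ : ℝ) (y : Bool) (z : ℝ) :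
    0 ≤ truncStudentPDF ν μ y z :=
  div_nonneg (Set.indicator_nonneg (fun z _ => (studentPDF_pos hν μ z).le) z)
    (integral_halfLine_studentPDF_pos hν μ y).le

lemma integrable_truncStudentPDF (hν : 0 < ν) (μ : ℝ) (y : Bool) :
    Integrable (truncStudentPDF ν μ y) :=
  ((integrable_studentPDF hν μ).indicator (measurableSet_halfLine y)).div_const _

lemma lintegral_truncStudentPDF (hν : 0 < ν) (μ : ℝ) (y : Bool) :
    ∫⁻ z, ENNReal.ofReal (truncStudentPDF ν μ y z) = 1 := by
  rw [← ofReal_integral_eq_lintegral_ofReal (integrable_truncStudentPDF hν μ y)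
    (ae_of_all _ (truncStudentPDF_nonneg hν μ y))]
  simp only [truncStudentPDF]
  rw [integral_div, integral_indicator (measurableSet_halfLine y),
    div_self (integral_halfLine_studentPDF_pos hν μ y).ne', ENNReal.ofReal_one]

lemma measurable_mulVec_coord (X : Matrix (Fin n) (Fin p) ℝ) (i : Fin n) :
    Measurable fun β : Fin p → ℝ => X.mulVec β i :=
  measurable_mulVec_apply (R := fun _ => X) (v := fun β => β) (fun _ _ => measurable_const)
    (fun i => measurable_pi_apply i) i

/-- The density of the latent pair `t = (lam, z)` given `β, y`. -/
def latentPDF (ν : ℝ) (X : Matrix (Fin n) (Fin p) ℝ) (y : Fin n → Bool) (β : Fin p → ℝ)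
    (t : (Fin n → ℝ) × (Fin n → ℝ)) : ℝ :=
  lamCondPDF ν X β t.2 t.1 * zCondPDF ν X y β t.2

/-- Lebesgue measure on pairs `(lam, z)` with positive `lam`. -/
def latentMeasure (n : ℕ) : Measure ((Fin n → ℝ) × (Fin n → ℝ)) :=
  (volume.restrict {lam : Fin n → ℝ | ∀ i, 0 < lam i}).prod volume

instance : SFinite (latentMeasure n) := by unfold latentMeasure; infer_instance

lemma setOf_pos_eq_pi : {lam : Fin n → ℝ | ∀ i, 0 < lam i} = Set.univ.pi fun _ => Set.Ioi 0 := by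
  ext; simp

lemma measurableSet_setOf_pos : MeasurableSet {lam : Fin n → ℝ | ∀ i, 0 < lam i} := by
  rw [setOf_pos_eq_pi]; exact MeasurableSet.univ_pi fun _ => measurableSet_Ioi

lemma ae_latentMeasure : ∀ᵐ t ∂(latentMeasure n), ∀ i, 0 < t.1 i :=
  Measure.quasiMeasurePreserving_fst.ae (ae_restrict_mem measurableSet_setOf_pos)

lemma rate_pos (hν : 0 < ν) (r : ℝ) : 0 < (ν + r ^ 2) / 2 := by positivity

lemma measurable_zCondPDF (ν : ℝ) (X : Matrix (Fin n) (Fin p) ℝ) (y : Fin n → Bool) :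
    Measurable fun q : (Fin p → ℝ) × (Fin n → ℝ) => zCondPDF ν X y q.1 q.2 := by
  unfold zCondPDF
  refine Finset.measurable_prod _ fun i _ => ?_
  have h1 : Measurable fun q : (Fin p → ℝ) × (Fin n → ℝ) => X.mulVec q.1 i :=
    (measurable_mulVec_coord X i).comp measurable_fst
  have h2 : Measurable fun q : (Fin p → ℝ) × (Fin n → ℝ) => q.2 i := by fun_prop
  have h3 := (measurable_truncStudentPDF ν (y i)).comp (h1.prodMk h2)
  exact h3

lemma measurable_lamCondPDF (ν : ℝ) (X : Matrix (Fin n) (Fin p) ℝ) :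
    Measurable fun q : (Fin p → ℝ) × (Fin n → ℝ) × (Fin n → ℝ) =>
      lamCondPDF ν X q.1 q.2.2 q.2.1 := by
  unfold lamCondPDF
  refine Finset.measurable_prod _ fun i _ => ?_
  have h1 : Measurable fun q : (Fin p → ℝ) × (Fin n → ℝ) × (Fin n → ℝ) => X.mulVec q.1 i :=
    (measurable_mulVec_coord X i).comp measurable_fst
  have h2 : Measurable fun q : (Fin p → ℝ) × (Fin n → ℝ) × (Fin n → ℝ) =>
      (ν + (q.2.2 i - X.mulVec q.1 i) ^ 2) / 2 := by fun_prop
  have h3 : Measurable fun q : (Fin p → ℝ) × (Fin n → ℝ) × (Fin n → ℝ) => q.2.1 i := by fun_prop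
  have h4 := (measurable_gammaPDFReal_uncurry ((ν + 1) / 2)).comp (h2.prodMk h3)
  exact h4

lemma measurable_latentPDF (ν : ℝ) (X : Matrix (Fin n) (Fin p) ℝ) (y : Fin n → Bool) :
    Measurable (Function.uncurry (latentPDF ν X y)) := by
  have h : Measurable fun q : (Fin p → ℝ) × (Fin n → ℝ) × (Fin n → ℝ) =>
      zCondPDF ν X y q.1 q.2.2 := by
    have hq : Measurable fun q : (Fin p → ℝ) × (Fin n → ℝ) × (Fin n → ℝ) => (q.1, q.2.2) := by
      fun_prop
    have := (measurable_zCondPDF ν X y).comp hq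
    exact this
  exact (measurable_lamCondPDF ν X).mul h

lemma zCondPDF_nonneg (hν : 0 < ν) (β : Fin p → ℝ) (z : Fin n → ℝ) : 0 ≤ zCondPDF ν X y β z :=
  Finset.prod_nonneg fun _ _ => truncStudentPDF_nonneg hν _ _ _

lemma lamCondPDF_nonneg (hν : 0 < ν) (β : Fin p → ℝ) (z lam : Fin n → ℝ) :
    0 ≤ lamCondPDF ν X β z lam :=
  Finset.prod_nonneg fun _ _ => gammaPDFReal_nonneg (by positivity) (rate_pos hν _) _

lemma latentPDF_nonneg (hν : 0 < ν) (β : Fin p → ℝ) (t : (Fin n → ℝ) × (Fin n → ℝ)) :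
    0 ≤ latentPDF ν X y β t :=
  mul_nonneg (lamCondPDF_nonneg hν _ _ _) (zCondPDF_nonneg hν _ _)

lemma betaCondPDF_nonneg (lam z : Fin n → ℝ) (β : Fin p → ℝ) :
    0 ≤ betaCondPDF X βa Sa lam z β := by
  simp only [betaCondPDF, normalPDF]
  positivity

lemma lintegral_zCondPDF (hν : 0 < ν) (β : Fin p → ℝ) :
    ∫⁻ z, ENNReal.ofReal (zCondPDF ν X y β z) = 1 := by
  simp only [zCondPDF]
  rw [volume_pi, lintegral_pi_ofReal_prod (f := fun i => truncStudentPDF ν (X.mulVec β i) (y i)) _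
    (fun i => truncStudentPDF_nonneg hν _ _) fun i => integrable_truncStudentPDF hν _ _]
  simp [lintegral_truncStudentPDF hν]

lemma setLIntegral_pos_prod_gammaPDFReal {a : ℝ} (ha : 0 < a) {r : Fin n → ℝ}
    (hr : ∀ i, 0 < r i) {c : ℝ} (hc : 0 ≤ c) :
    ∫⁻ lam in {lam : Fin n → ℝ | ∀ i, 0 < lam i},
      ENNReal.ofReal (∏ i, c * gammaPDFReal a (r i) (lam i)) = ENNReal.ofReal c ^ n := by
  rw [setOf_pos_eq_pi, volume_pi, Measure.restrict_pi_pi,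
    lintegral_pi_ofReal_prod (f := fun i l => c * gammaPDFReal a (r i) l) _
      (fun i l => mul_nonneg hc (gammaPDFReal_nonneg ha (hr i) l))
      fun i => ((integrable_gammaPDFReal ha (hr i)).const_mul c).integrableOn]
  have h : ∀ i, ∫⁻ l in Set.Ioi 0, ENNReal.ofReal (c * gammaPDFReal a (r i) l)
      = ENNReal.ofReal c := fun i => by
    simp_rw [ENNReal.ofReal_mul hc]
    rw [lintegral_const_mul' _ _ ENNReal.ofReal_ne_top]
    have := setLIntegral_Ioi_gammaPDF ha (hr i)
    simp only [gammaPDF] at this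
    rw [this, mul_one]
  simp [h]

/-- Integrate `lam` first: its integral is the same for all `z`, and the density of `z` then has
mass one. -/
lemma lintegral_latentMeasure {g : (Fin n → ℝ) → (Fin n → ℝ) → ℝ}
    (hg : Measurable (Function.uncurry g)) (hg0 : ∀ lam z, 0 ≤ g lam z) (hν : 0 < ν)
    (β : Fin p → ℝ) {C : ENNReal}
    (hC : ∀ z, ∫⁻ lam in {lam : Fin n → ℝ | ∀ i, 0 < lam i}, ENNReal.ofReal (g lam z) = C) :
    ∫⁻ t, ENNReal.ofReal (g t.1 t.2 * zCondPDF ν X y β t.2) ∂(latentMeasure n) = C := by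
  have hz := (measurable_zCondPDF ν X y).comp (measurable_prodMk_left (x := β))
  simp only [Function.comp_def] at hz
  have hm : Measurable fun t : (Fin n → ℝ) × (Fin n → ℝ) =>
      ENNReal.ofReal (g t.1 t.2 * zCondPDF ν X y β t.2) :=
    (hg.mul (hz.comp measurable_snd)).ennreal_ofReal
  rw [latentMeasure, lintegral_prod_symm _ hm.aemeasurable]
  simp_rw [ENNReal.ofReal_mul (hg0 _ _)]
  calc _ = ∫⁻ z, C * ENNReal.ofReal (zCondPDF ν X y β z) := by
        refine lintegral_congr fun z => ?_
        rw [lintegral_mul_const' _ _ ENNReal.ofReal_ne_top, hC]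
    _ = C := by rw [lintegral_const_mul _ hz.ennreal_ofReal, lintegral_zCondPDF hν, mul_one]

lemma lintegral_latentPDF (hν : 0 < ν) (β : Fin p → ℝ) :
    ∫⁻ t, ENNReal.ofReal (latentPDF ν X y β t) ∂(latentMeasure n) = 1 := by
  have hm : Measurable (Function.uncurry fun lam z : Fin n → ℝ => lamCondPDF ν X β z lam) := by
    have := (measurable_lamCondPDF ν X).comp (measurable_prodMk_left (x := β))
    exact this
  refine lintegral_latentMeasure (g := fun lam z => lamCondPDF ν X β z lam) hm
    (fun lam z => lamCondPDF_nonneg hν β z lam) hν β fun z => ?_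
  simpa [lamCondPDF] using setLIntegral_pos_prod_gammaPDFReal (a := (ν + 1) / 2)
    (r := fun i => (ν + (z i - X.mulVec β i) ^ 2) / 2) (by positivity)
    (fun i => rate_pos hν _) zero_le_one

lemma lintegral_exp_mul_latentPDF (hν : 0 < ν) (β : Fin p → ℝ) :
    ∫⁻ t, ENNReal.ofReal ((∏ i, Real.exp ((ν + (t.2 i - X.mulVec β i) ^ 2) / 2 * t.1 i / 2)) *
      latentPDF ν X y β t) ∂(latentMeasure n) = ENNReal.ofReal (2 ^ ((ν + 1) / 2)) ^ n := by
  simp only [latentPDF, ← mul_assoc]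
  have hm : Measurable (Function.uncurry fun lam z : Fin n → ℝ => lamCondPDF ν X β z lam) := by
    have := (measurable_lamCondPDF ν X).comp (measurable_prodMk_left (x := β))
    exact this
  have he : Measurable fun q : (Fin n → ℝ) × (Fin n → ℝ) =>
      ∏ i, Real.exp ((ν + (q.2 i - X.mulVec β i) ^ 2) / 2 * q.1 i / 2) := by fun_prop
  refine lintegral_latentMeasure (g := fun lam z =>
    (∏ i, Real.exp ((ν + (z i - X.mulVec β i) ^ 2) / 2 * lam i / 2)) * lamCondPDF ν X β z lam)
    (he.mul hm)
    (fun lam z => mul_nonneg (by positivity) (lamCondPDF_nonneg hν β z lam)) hν β fun z => ?_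
  simp_rw [lamCondPDF, ← Finset.prod_mul_distrib, exp_mul_gammaPDFReal (rate_pos hν _)]
  exact setLIntegral_pos_prod_gammaPDFReal (by positivity) (fun i => half_pos (rate_pos hν _))
    (by positivity)

lemma measurable_betaCondPDF_mul_latentPDF (ν : ℝ) (X : Matrix (Fin n) (Fin p) ℝ)
    (y : Fin n → Bool) (βa : Fin p → ℝ) (Sa : Matrix (Fin p) (Fin p) ℝ) (β : Fin p → ℝ) :
    Measurable fun q : (Fin p → ℝ) × (Fin n → ℝ) × (Fin n → ℝ) =>
      ENNReal.ofReal (betaCondPDF X βa Sa q.2.1 q.2.2 q.1 * latentPDF ν X y β q.2) := by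
  have h : Measurable fun q : (Fin p → ℝ) × (Fin n → ℝ) × (Fin n → ℝ) =>
      latentPDF ν X y β q.2 := by
    have hq : Measurable fun q : (Fin p → ℝ) × (Fin n → ℝ) × (Fin n → ℝ) => (β, q.2) := by
      fun_prop
    have := (measurable_latentPDF ν X y).comp hq
    exact this
  exact ((measurable_betaCondPDF X βa Sa).mul h).ennreal_ofReal

/-! ### The transition density and its diagonal -/

lemma transitionDensity_eq (β β' : Fin p → ℝ) :
    transitionDensity ν X y βa Sa β β' = ∫⁻ t, ENNReal.ofReal
      (betaCondPDF X βa Sa t.1 t.2 β' * latentPDF ν X y β t) ∂(latentMeasure n) := by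
  have hm : Measurable fun t : (Fin n → ℝ) × (Fin n → ℝ) =>
      ENNReal.ofReal (betaCondPDF X βa Sa t.1 t.2 β' * latentPDF ν X y β t) := by
    have := (measurable_betaCondPDF_mul_latentPDF ν X y βa Sa β).comp
      (measurable_prodMk_left (x := β'))
    exact this
  rw [latentMeasure, lintegral_prod _ hm.aemeasurable, transitionDensity]
  simp only [latentPDF, mul_assoc]

theorem isProbabilityMeasure_transition (hν : 0 < ν) (hSa : Sa.PosDef) (β : Fin p → ℝ) :
    IsProbabilityMeasure (transition ν X y βa Sa β) := by
  refine ⟨?_⟩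
  rw [transition, withDensity_apply _ MeasurableSet.univ, Measure.restrict_univ]
  simp_rw [transitionDensity_eq]
  rw [lintegral_lintegral_swap
    (measurable_betaCondPDF_mul_latentPDF ν X y βa Sa β).aemeasurable, ← lintegral_latentPDF (X := X) (y := y) hν β]
  refine lintegral_congr_ae ?_
  filter_upwards [ae_latentMeasure] with t ht
  simp_rw [mul_comm (betaCondPDF _ _ _ _ _ _), ENNReal.ofReal_mul (latentPDF_nonneg hν β t)]
  rw [lintegral_const_mul' _ _ ENNReal.ofReal_ne_top, lintegral_betaCondPDF βa hSa ht, mul_one]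

theorem lintegral_transitionDensity_diag_lt_top (hν : 2 < ν) (hSa : Sa.PosDef) :
    ∫⁻ β, transitionDensity ν X y βa Sa β β < ⊤ := by
  obtain ⟨C, hC, hle⟩ := exists_betaCondPDF_le hν X βa hSa
  have hν0 : 0 < ν := by linarith
  calc ∫⁻ β, transitionDensity ν X y βa Sa β β
      ≤ ∫⁻ β : Fin p → ℝ, ENNReal.ofReal (C * (1 + ‖β‖) ^ (-((p : ℝ) + 1))) *
          ENNReal.ofReal (2 ^ ((ν + 1) / 2)) ^ n := by
        refine lintegral_mono fun β => ?_
        have h0 : 0 ≤ C * (1 + ‖β‖) ^ (-((p : ℝ) + 1)) := by positivity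
        rw [transitionDensity_eq, ← lintegral_exp_mul_latentPDF (X := X) (y := y) hν0 β,
          ← lintegral_const_mul' _ _ ENNReal.ofReal_ne_top]
        refine lintegral_mono_ae ?_
        filter_upwards [ae_latentMeasure] with t ht
        rw [← ENNReal.ofReal_mul h0]
        refine ENNReal.ofReal_le_ofReal ?_
        refine (mul_le_mul_of_nonneg_right (hle t.1 t.2 β ht)
          (latentPDF_nonneg (y := y) hν0 β t)).trans (le_of_eq ?_)
        ring
    _ < ⊤ := by
        rw [lintegral_mul_const' _ _ (by finiteness)]
        refine ENNReal.mul_lt_top ?_ (by finiteness)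
        -- The exponent `p + 1` exceeds the dimension `p`.
        have hint : Integrable fun β : Fin p → ℝ => C * (1 + ‖β‖) ^ (-((p : ℝ) + 1)) :=
          (integrable_one_add_norm (by simp)).const_mul C
        exact hint.lintegral_lt_top

/-! ### Normalization of the posterior and reversibility -/

/-- Likelihood times prior density. -/
def posteriorKernel (ν : ℝ) (X : Matrix (Fin n) (Fin p) ℝ) (y : Fin n → Bool)
    (βa : Fin p → ℝ) (Sa : Matrix (Fin p) (Fin p) ℝ) (β : Fin p → ℝ) : ℝ :=
  likelihood ν X y β * normalPDF βa Sa⁻¹ β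

lemma likelihood_eq (hν : 0 < ν) (β : Fin p → ℝ) :
    likelihood ν X y β = ∏ i, ∫ t in halfLine (y i), studentPDF ν (X.mulVec β i) t :=
  Finset.prod_congr rfl fun _ _ => (integral_halfLine_studentPDF hν _ _).symm

lemma likelihood_pos (hν : 0 < ν) (β : Fin p → ℝ) : 0 < likelihood ν X y β := by
  rw [likelihood_eq hν]
  exact Finset.prod_pos fun _ _ => integral_halfLine_studentPDF_pos hν _ _

lemma likelihood_le_one (hν : 0 < ν) (β : Fin p → ℝ) : likelihood ν X y β ≤ 1 := by
  rw [likelihood_eq hν]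
  refine Finset.prod_le_one (fun _ _ => (integral_halfLine_studentPDF_pos hν _ _).le) fun i _ => ?_
  rw [← integral_studentPDF hν (X.mulVec β i)]
  exact setIntegral_le_integral (integrable_studentPDF hν _)
    (ae_of_all _ fun z => (studentPDF_pos hν _ z).le)

lemma measurable_posteriorKernel (hν : 0 < ν) (βa : Fin p → ℝ) (Sa : Matrix (Fin p) (Fin p) ℝ) :
    Measurable (posteriorKernel ν X y βa Sa) := by
  unfold posteriorKernel
  refine Measurable.mul ?_ (measurable_normalPDF (fun _ _ => measurable_const)
    (fun _ => measurable_const) fun i => measurable_pi_apply i)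
  rw [show likelihood ν X y = fun β => ∏ i, ∫ t in halfLine (y i), studentPDF ν (X.mulVec β i) t
    from funext fun β => likelihood_eq hν β]
  refine Finset.measurable_prod _ fun i _ => ?_
  have := (measurable_integral_halfLine_studentPDF ν (y i)).comp (measurable_mulVec_coord X i)
  exact this

lemma posteriorKernel_pos (hν : 0 < ν) (hSa : Sa.PosDef) (β : Fin p → ℝ) :
    0 < posteriorKernel ν X y βa Sa β :=
  mul_pos (likelihood_pos hν β) (normalPDF_pos βa hSa.inv β)

lemma lintegral_posteriorKernel_pos (hν : 0 < ν) (hSa : Sa.PosDef) :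
    0 < ∫⁻ β, ENNReal.ofReal (posteriorKernel ν X y βa Sa β) := by
  rw [lintegral_pos_iff_support (measurable_posteriorKernel hν βa Sa).ennreal_ofReal,
    show Function.support (fun β => ENNReal.ofReal (posteriorKernel ν X y βa Sa β)) = Set.univ from
      Set.eq_univ_of_forall fun β => by simpa using posteriorKernel_pos hν hSa β]
  exact Measure.measure_univ_pos.mpr (NeZero.ne _)

lemma lintegral_posteriorKernel_le_one (hν : 0 < ν) (hSa : Sa.PosDef) :
    ∫⁻ β, ENNReal.ofReal (posteriorKernel ν X y βa Sa β) ≤ 1 := by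
  rw [← lintegral_normalPDF βa hSa.inv]
  refine lintegral_mono fun β => ENNReal.ofReal_le_ofReal ?_
  exact mul_le_of_le_one_left (normalPDF_pos βa hSa.inv β).le (likelihood_le_one hν β)

lemma unnormalizedPosterior_univ : unnormalizedPosterior ν X y βa Sa Set.univ
    = ∫⁻ β, ENNReal.ofReal (posteriorKernel ν X y βa Sa β) := by
  rw [unnormalizedPosterior, withDensity_apply _ MeasurableSet.univ, Measure.restrict_univ]
  rfl

theorem isProbabilityMeasure_posterior (hν : 0 < ν) (hSa : Sa.PosDef) :
    IsProbabilityMeasure (posterior ν X y βa Sa) := by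
  refine ⟨?_⟩
  rw [posterior, Measure.smul_apply, smul_eq_mul, unnormalizedPosterior_univ]
  exact ENNReal.inv_mul_cancel (lintegral_posteriorKernel_pos hν hSa).ne'
    ((lintegral_posteriorKernel_le_one hν hSa).trans_lt ENNReal.one_lt_top).ne

/-- The normalizers of the truncated Student densities cancel the likelihood. The mixture identity
then turns each Student–Gamma factor into a Gaussian whose exponent is the only place where `β`
survives. -/
lemma posteriorKernel_mul_latentPDF (hν : 0 < ν) (hSa : Sa.PosDef)
    {t : (Fin n → ℝ) × (Fin n → ℝ)} (ht : ∀ i, 0 < t.1 i) :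
    ∃ a : ℝ, ∀ β, posteriorKernel ν X y βa Sa β * latentPDF ν X y β t
      = a * Real.exp (-jointForm X βa Sa t.1 t.2 β / 2) := by
  refine ⟨Real.sqrt (((2 * Real.pi) ^ p)⁻¹ * Sa.det) * ∏ i, ((halfLine (y i)).indicator 1 (t.2 i) *
    gammaPDFReal (ν / 2) (ν / 2) (t.1 i) * (Real.sqrt (2 * Real.pi * (t.1 i)⁻¹))⁻¹), fun β => ?_⟩
  have hlik : likelihood ν X y β * latentPDF ν X y β t
      = ∏ i, ((halfLine (y i)).indicator 1 (t.2 i) *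
        gammaPDFReal (ν / 2) (ν / 2) (t.1 i) * (Real.sqrt (2 * Real.pi * (t.1 i)⁻¹))⁻¹ *
        Real.exp (-(t.1 i * (t.2 i - X.mulVec β i) ^ 2) / 2)) := by
    rw [likelihood_eq hν, latentPDF, lamCondPDF, zCondPDF, ← Finset.prod_mul_distrib,
      ← Finset.prod_mul_distrib]
    refine Finset.prod_congr rfl fun i _ => ?_
    have hI := (integral_halfLine_studentPDF_pos hν (X.mulVec β i) (y i)).ne'
    have hst := studentPDF_mul_gammaPDFReal hν (X.mulVec β i) (t.2 i) (ht i)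
    have hexp : gaussianPDFReal (X.mulVec β i) (Real.toNNReal (t.1 i)⁻¹) (t.2 i)
        = (Real.sqrt (2 * Real.pi * (t.1 i)⁻¹))⁻¹ *
          Real.exp (-(t.1 i * (t.2 i - X.mulVec β i) ^ 2) / 2) := by
      rw [gaussianPDFReal, Real.coe_toNNReal _ (inv_pos.mpr (ht i)).le]
      congr 2
      have := (ht i).ne'
      field_simp
    rw [truncStudentPDF]
    by_cases hz : t.2 i ∈ halfLine (y i)
    · rw [Set.indicator_of_mem hz, Set.indicator_of_mem hz, Pi.one_apply, one_mul, mul_assoc,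
        ← hexp, ← hst]
      field_simp
    · rw [Set.indicator_of_notMem hz, Set.indicator_of_notMem hz]
      simp
  rw [posteriorKernel, normalPDF_inv hSa, jointForm, neg_add, add_div, Real.exp_add,
    mul_right_comm, hlik, Finset.prod_mul_distrib, ← Real.exp_sum, ← Finset.sum_neg_distrib,
    Finset.sum_div]
  ring

/-- Both sides are proportional, as functions of `β`, to the same exponential. Evaluating the ratio
at `β = 0` names the factor `w(t)` without computing any normalizing constant. -/
lemma posteriorKernel_mul_latentPDF_eq_mul_betaCondPDF (hν : 0 < ν) (hSa : Sa.PosDef)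
    {t : (Fin n → ℝ) × (Fin n → ℝ)} (ht : ∀ i, 0 < t.1 i) (β : Fin p → ℝ) :
    posteriorKernel ν X y βa Sa β * latentPDF ν X y β t
      = posteriorKernel ν X y βa Sa 0 * latentPDF ν X y 0 t / betaCondPDF X βa Sa t.1 t.2 0 *
        betaCondPDF X βa Sa t.1 t.2 β := by
  obtain ⟨a, ha⟩ := posteriorKernel_mul_latentPDF (X := X) (y := y) (βa := βa) hν hSa ht
  obtain ⟨d, hd⟩ := betaCondPDF_eq_exp_jointForm (X := X) (βa := βa) hSa ht t.2
  have h0 := (betaCondPDF_pos (X := X) βa hSa ht t.2 0).ne'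
  rw [div_mul_eq_mul_div, eq_div_iff h0, ha, ha, hd, hd]
  ring

theorem exists_markovOperator (hν : 2 < ν) (hSa : Sa.PosDef) :
    ∃ K : meanZeroL2 (posterior ν X y βa Sa) →L[ℝ] meanZeroL2 (posterior ν X y βa Sa),
      IsMarkovOperator (transition ν X y βa Sa) (posterior ν X y βa Sa) K ∧
      K.IsPositive ∧ IsTraceClass K := by
  have hν0 : 0 < ν := by linarith
  set Z := ∫⁻ β, ENNReal.ofReal (posteriorKernel ν X y βa Sa β) with hZ
  have hZ0 : Z ≠ 0 := (lintegral_posteriorKernel_pos hν0 hSa).ne'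
  have hZt : Z ≠ ⊤ := ((lintegral_posteriorKernel_le_one hν0 hSa).trans_lt ENNReal.one_lt_top).ne
  have hc : 0 < Z.toReal := ENNReal.toReal_pos hZ0 hZt
  have hum := measurable_posteriorKernel (X := X) (y := y) hν0 βa Sa
  have hhm := measurable_latentPDF ν X y
  have hbm := measurable_betaCondPDF X βa Sa
  -- The target must be the normalized posterior, so `u` and `w` are both divided by the total mass,
  -- which preserves the balance relation.
  refine exists_positive_isTraceClass_dataAugmentation (vol := volume) (τ := latentMeasure n)
    (u := fun β => posteriorKernel ν X y βa Sa β / Z.toReal)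
    (b := fun β t => betaCondPDF X βa Sa t.1 t.2 β) (h := latentPDF ν X y)
    (w := fun t => posteriorKernel ν X y βa Sa 0 * latentPDF ν X y 0 t /
      betaCondPDF X βa Sa t.1 t.2 0 / Z.toReal)
    (hum.div_const _) hbm ?_ (fun β => div_pos (posteriorKernel_pos hν0 hSa β) hc)
    (fun β t => betaCondPDF_nonneg _ _ _) (fun t => ?_) ?_ ?_ (lintegral_latentPDF hν0) ?_ _ ?_
    fun β => ?_
  · exact ((((hhm.comp measurable_prodMk_left).const_mul _).div
      (hbm.comp (measurable_prodMk_left (x := (0 : Fin p → ℝ)))))).div_const _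
  · exact div_nonneg (div_nonneg (mul_nonneg (posteriorKernel_pos hν0 hSa 0).le
      (latentPDF_nonneg hν0 0 t)) (betaCondPDF_nonneg _ _ _)) hc.le
  · filter_upwards [ae_latentMeasure] with t ht β
    rw [div_mul_eq_mul_div, div_mul_eq_mul_div,
      posteriorKernel_mul_latentPDF_eq_mul_betaCondPDF hν0 hSa ht]
  · filter_upwards [ae_latentMeasure] with t ht
    exact lintegral_betaCondPDF βa hSa ht t.2
  · simpa only [transitionDensity_eq] using
      lintegral_transitionDensity_diag_lt_top (X := X) (y := y) (βa := βa) hν hSa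
  · rw [posterior, unnormalizedPosterior_univ, unnormalizedPosterior, ← withDensity_smul _
      (by exact hum.ennreal_ofReal)]
    congr 1
    ext β
    rw [Pi.smul_apply, smul_eq_mul, ENNReal.ofReal_div_of_pos hc, ENNReal.ofReal_toReal hZt,
      ENNReal.div_eq_inv_mul]
    rfl
  · rw [transition]
    congr 1
    ext β'
    exact transitionDensity_eq β β'

end Model

end Robit

end

theorem theorem1 (ν : ℝ) (hν : 2 < ν) (n p : ℕ) (X : Matrix (Fin n) (Fin p) ℝ)
    (y : Fin n → Bool) (βa : Fin p → ℝ) (Sa : Matrix (Fin p) (Fin p) ℝ) (hSa : Sa.PosDef) :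
    IsProbabilityMeasure (Robit.posterior ν X y βa Sa) ∧
    (∀ β, IsProbabilityMeasure (Robit.transition ν X y βa Sa β)) ∧
    (∫⁻ β, Robit.transitionDensity ν X y βa Sa β β) < ⊤ ∧
    ∃ K : Robit.meanZeroL2 (Robit.posterior ν X y βa Sa) →L[ℝ]
        Robit.meanZeroL2 (Robit.posterior ν X y βa Sa),
      Robit.IsMarkovOperator (Robit.transition ν X y βa Sa) (Robit.posterior ν X y βa Sa) K ∧
      K.IsPositive ∧ Robit.IsTraceClass K :=
  have hν0 : 0 < ν := by linarith
  ⟨Robit.isProbabilityMeasure_posterior hν0 hSa,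
    Robit.isProbabilityMeasure_transition hν0 hSa,
    Robit.lintegral_transitionDensity_diag_lt_top hν hSa,
    Robit.exists_markovOperator hν hSa⟩
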